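/- **Theorem (fifth order tempered quasi-compact approximation).** Let $1<\alpha<2$ with $862-\alpha-285\alpha^2-15\alpha^3+15\alpha^4\neq 0$, let $\lambda\ge 0$, and let $u\in C^8(\mathbb R)$ be real-valued such that $u$ and all its derivatives up to order $8$ belong to $L^1(\mathbb R)$. Let $$D^{\alpha,\lambda}u(x)=\frac{e^{-\lambda x}}{\Gamma(2-\alpha)}\frac{d^2}{dx^2}\int_{-\infty}^x (x-s)^{1-\alpha}e^{\lambda s}u(s)\,ds$$ be the left Riemann–Liouville tempered fractional derivative, and for $p\in\mathbb Z$, $h>0$ let $$\Delta_p^{\alpha,\lambda}u(x)=\frac1{h^\alpha}\sum_{k=0}^\infty g_k^{(\alpha)}e^{-(k-p)\lambda h}u(x-(k-p)h),\qquad g_k^{(\alpha)}=\frac{\Gamma(k-\alpha)}{\Gamma(-\alpha)\Gamma(k+1)},$$ be the left shifted tempered Grünwald–Letnikov operator. Put $d=862-\alpha-285\alpha^2-15\alpha^3+15\alpha^4$ and $$m=\frac{350+331\alpha-15\alpha^2-75\alpha^3-15\alpha^4}{2d},\qquad n=\frac{566-329\alpha-135\alpha^2+105\alpha^3-15\alpha^4}{2d},$$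 $$\mu_1=\frac{566+329\alpha-135\alpha^2-105\alpha^3-15\alpha^4}{2d},\quad \mu_0=\frac{862+\alpha-285\alpha^2+15\alpha^3+15\alpha^4}{d},\quad \mu_{-1}=\frac{350-331\alpha-15\alpha^2+75\alpha^3-15\alpha^4}{2d}.$$ Then $D^{\alpha,\lambda}u$ is well defined on $\mathbb R$ (the integral converges absolutely for every $x$ and is a $C^2$ function of $x$), the series defining $\Delta_p^{\alpha,\lambda}u(x)$ converge absolutely for all $p\in\mathbb Z$, $h>0$, $x\in\mathbb R$, and, as $h\to0^+$, $$m e^{-\lambda h}D^{\alpha,\lambda}u(x-h)+D^{\alpha,\lambda}u(x)+n e^{\lambda h}D^{\alpha,\lambda}u(x+h)=\mu_1\Delta_1^{\alpha,\lambda}u(x)+\mu_0\Delta_0^{\alpha,\lambda}u(x)+\mu_{-1}\Delta_{-1}^{\alpha,\lambda}u(x)+O(h^5)$$ uniformly in $x\in\mathbb R$. -/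

import Mathlib

open MeasureTheory Set

noncomputable section

/-- The singular integral `∫_{-∞}^x (x - s)^{n - α - 1} f(s) ds` with `n = ⌈α⌉`, so that
`n - 1 < α < n` when `α > 0` is not an integer. -/
def leftSingularIntegral (α : ℝ) (f : ℝ → ℝ) (x : ℝ) : ℝ :=
  ∫ s in Iio x, (x - s) ^ ((⌈α⌉₊ : ℝ) - α - 1) * f s

/-- The left Riemann-Liouville fractional derivative on `(-∞, x)` of non-integer order `α > 0`:
`1 / Γ(n - α) * (d/dx)^n ∫_{-∞}^x (x - s)^{n - α - 1} f(s) ds` with `n = ⌈α⌉`. -/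
def leftRLDeriv (α : ℝ) (f : ℝ → ℝ) (x : ℝ) : ℝ :=
  1 / Real.Gamma ((⌈α⌉₊ : ℝ) - α) * iteratedDeriv ⌈α⌉₊ (leftSingularIntegral α f) x

/-- The left Riemann-Liouville tempered fractional derivative
`e^{-λ x} D^α (e^{λ x} u(x))` on `(-∞, x)`. -/
def leftTemperedDeriv (α lam : ℝ) (u : ℝ → ℝ) (x : ℝ) : ℝ :=
  Real.exp (-lam * x) * leftRLDeriv α (fun s => Real.exp (lam * s) * u s) x

/-- The Grünwald weight `g_k = Γ(k - α) / (Γ(-α) Γ(k + 1))`. -/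
def grunwaldWeight (α : ℝ) (k : ℕ) : ℝ :=
  Real.Gamma ((k : ℝ) - α) / (Real.Gamma (-α) * Real.Gamma ((k : ℝ) + 1))

/-- The `k`-th term `g_k e^{-(k - p) λ h} u(x - (k - p) h)` of the shifted tempered
Grünwald-Letnikov series. -/
def temperedGrunwaldTerm (α lam : ℝ) (p : ℤ) (h : ℝ) (u : ℝ → ℝ) (x : ℝ) (k : ℕ) : ℝ :=
  grunwaldWeight α k * Real.exp (-((k : ℝ) - p) * lam * h) * u (x - ((k : ℝ) - p) * h)

/-- The left shifted tempered Grünwald-Letnikov operator. -/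
def temperedGrunwald (α lam : ℝ) (p : ℤ) (h : ℝ) (u : ℝ → ℝ) (x : ℝ) : ℝ :=
  1 / h ^ α * ∑' k : ℕ, temperedGrunwaldTerm α lam p h u x k

/-- The common denominator of the coefficients (up to a factor `2`). -/
def coeffDen (α : ℝ) : ℝ := 862 - α - 285 * α ^ 2 - 15 * α ^ 3 + 15 * α ^ 4

/-- The coefficient of `e^{-λ h} u(x - h)`. -/
def coeffM (α : ℝ) : ℝ :=
  (350 + 331 * α - 15 * α ^ 2 - 75 * α ^ 3 - 15 * α ^ 4) / (2 * coeffDen α)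

/-- The coefficient of `e^{λ h} u(x + h)`. -/
def coeffN (α : ℝ) : ℝ :=
  (566 - 329 * α - 135 * α ^ 2 + 105 * α ^ 3 - 15 * α ^ 4) / (2 * coeffDen α)

/-- The weight of the operator with shift `p = 1`. -/
def coeffMuOne (α : ℝ) : ℝ :=
  (566 + 329 * α - 135 * α ^ 2 - 105 * α ^ 3 - 15 * α ^ 4) / (2 * coeffDen α)

/-- The weight of the operator with shift `p = 0`. -/
def coeffMuZero (α : ℝ) : ℝ :=
  (862 + α - 285 * α ^ 2 + 15 * α ^ 3 + 15 * α ^ 4) / coeffDen α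

/-- The weight of the operator with shift `p = -1`. -/
def coeffMuNegOne (α : ℝ) : ℝ :=
  (350 - 331 * α - 15 * α ^ 2 + 75 * α ^ 3 - 15 * α ^ 4) / (2 * coeffDen α)

/-- The quasi-compact operator `v ↦ m e^{-λ h} v(x - h) + v(x) + n e^{λ h} v(x + h)`. -/
def quasiCompactOp (α lam h : ℝ) (v : ℝ → ℝ) (x : ℝ) : ℝ :=
  coeffM α * Real.exp (-lam * h) * v (x - h) + v x + coeffN α * Real.exp (lam * h) * v (x + h)

end

/-! Everything becomes a Fourier multiplier. Write `u x = ∫ e^{2πiωx} φ(ω) dω` with `φ` the Fourier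
transform of `u`, and put `s = λ + 2πiω`. Conjugation by `e^{λx}` moves the frequency from `2πiω` to
`s`, so `D^{α,λ}` multiplies `φ` by `s^α`, the weighted shifts by `±h` multiply by `e^{±sh}`, and
`Δ_p` multiplies by `h^{-α} e^{psh} (1 - e^{-sh})^α`, by the binomial series.

With `z = sh`, the truncation error has multiplier `h^{-α} (z^α Q(z) - (1 - e^{-z})^α S(z))`, where
`Q` and `S` are `quasiCompactSymbol` and `shiftSymbol`. The five coefficients make the Taylor
coefficients of `Q(z) - ((1 - e^{-z})/z)^α S(z)` vanish through order four (`symbol_order_five`).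
Hence the bracket is `O(|z|^{5+α})` on the strip `0 ≤ Re z ≤ λ` (`exists_symbol_bound`), and the
multiplier is `O(h^5 |s|^{5+α})`. Eight integrable derivatives give `φ = O((1+|ω|)^{-8})`, so
`|s|^{5+α} |φ|` is integrable because `α < 2`. Its integral bounds the error uniformly in `x`, since
`|e^{2πiωx}| = 1`.

The delicate points come from `λ = 0`: `s` then lies on the imaginary axis and passes through `0`,
and `e^{-sh}` lies on the unit circle. -/

/-! ### Grünwald weights and the binomial series on the closed disc. -/

section GrunwaldWeights

open Filter Topology

theorem grunwaldWeight_zero {α : ℝ} (hα : ∀ k : ℕ, α ≠ k) : grunwaldWeight α 0 = 1 := by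
  have h : Real.Gamma (-α) ≠ 0 := Real.Gamma_ne_zero fun m hm => hα m (by linarith)
  simp [grunwaldWeight, h]

theorem succ_mul_grunwaldWeight_succ {α : ℝ} (hα : ∀ k : ℕ, α ≠ k) (k : ℕ) :
    (k + 1) * grunwaldWeight α (k + 1) = (k - α) * grunwaldWeight α k := by
  have h : Real.Gamma (-α) ≠ 0 := Real.Gamma_ne_zero fun m hm => hα m (by linarith)
  have h1 : Real.Gamma ((k : ℝ) + 1) ≠ 0 := (Real.Gamma_pos_of_pos (by positivity)).ne'
  have h2 : (k : ℝ) + 1 ≠ 0 := by positivity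
  have h3 : (k : ℝ) - α ≠ 0 := sub_ne_zero.2 (hα k).symm
  simp only [grunwaldWeight, Nat.cast_add, Nat.cast_one]
  rw [show (k : ℝ) + 1 - α = k - α + 1 by ring, Real.Gamma_add_one h3, Real.Gamma_add_one h2]
  field_simp

theorem succ_mul_choose_succ (a : ℂ) (k : ℕ) :
    (k + 1) * Ring.choose a (k + 1) = (a - k) * Ring.choose a k := by
  have hk : ((Nat.factorial k : ℕ) : ℂ) ≠ 0 := by exact_mod_cast k.factorial_ne_zero
  have hk2 : ((k : ℂ) + 1) ≠ 0 := by exact_mod_cast k.succ_ne_zero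
  rw [Ring.choose_eq_smul, Ring.choose_eq_smul, descPochhammer_succ_right,
    Polynomial.smeval_mul, Polynomial.smeval_sub, Polynomial.smeval_X,
    Polynomial.smeval_natCast]
  simp only [Nat.factorial_succ, smul_eq_mul, Nat.cast_mul, Nat.cast_add, Nat.cast_one,
    pow_one, pow_zero, nsmul_eq_mul, mul_one]
  field_simp

theorem ofReal_grunwaldWeight {α : ℝ} (hα : ∀ k : ℕ, α ≠ k) (k : ℕ) :
    (grunwaldWeight α k : ℂ) = (-1) ^ k * Ring.choose (α : ℂ) k := by
  induction k with
  | zero => simp [grunwaldWeight_zero hα]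
  | succ k ih =>
    have h1 := succ_mul_choose_succ (α : ℂ) k
    have h2 : ((k + 1 : ℕ) : ℂ) * grunwaldWeight α (k + 1) = (k - α) * grunwaldWeight α k := by
      exact_mod_cast succ_mul_grunwaldWeight_succ hα k
    have hk : ((k + 1 : ℕ) : ℂ) ≠ 0 := by exact_mod_cast k.succ_ne_zero
    refine mul_left_cancel₀ hk ?_
    rw [h2, ih]
    push_cast
    linear_combination (-1) ^ k * h1

/-- The recurrence telescopes. This closed form of the partial sums replaces any asymptotics of the
Gamma function in the proof of summability. -/
theorem mul_sum_grunwaldWeight {α : ℝ} (hα : ∀ k : ℕ, α ≠ k) (n : ℕ) :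
    α * ∑ k ∈ Finset.range (n + 1), grunwaldWeight α k
      = -((n + 1) * grunwaldWeight α (n + 1)) := by
  induction n with
  | zero =>
    have h := succ_mul_grunwaldWeight_succ hα 0
    simp only [Nat.cast_zero, zero_add, zero_sub, one_mul] at h
    simp [h, grunwaldWeight_zero hα]
  | succ n ih =>
    have h := succ_mul_grunwaldWeight_succ hα (n + 1)
    rw [Finset.sum_range_succ, mul_add, ih]
    push_cast at h ⊢
    rw [h]
    ring

theorem grunwaldWeight_add_two_nonneg {α : ℝ} (hα₁ : 1 < α) (hα₂ : α < 2) (hα : ∀ k : ℕ, α ≠ k)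
    (k : ℕ) : 0 ≤ grunwaldWeight α (k + 2) := by
  induction k with
  | zero =>
    have h := succ_mul_grunwaldWeight_succ hα 0
    have h1 := succ_mul_grunwaldWeight_succ hα 1
    simp only [Nat.cast_zero, zero_add, zero_sub, one_mul, grunwaldWeight_zero hα] at h
    rw [h] at h1
    norm_num at h1 ⊢
    nlinarith
  | succ k ih =>
    have h := succ_mul_grunwaldWeight_succ hα (k + 2)
    push_cast at h
    have h2 : 0 ≤ ((k : ℝ) + 2 - α) * grunwaldWeight α (k + 2) :=
      mul_nonneg (by have := k.cast_nonneg (α := ℝ); linarith) ih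
    rw [← h] at h2
    exact nonneg_of_mul_nonneg_right h2 (by positivity)

theorem ne_natCast_of_mem_Ioo {α : ℝ} (hα₁ : 1 < α) (hα₂ : α < 2) (k : ℕ) : α ≠ k := by
  rintro rfl
  have h1 : 1 < k := by exact_mod_cast hα₁
  have h2 : k < 2 := by exact_mod_cast hα₂
  omega

/-- The weights are nonnegative from index 2 on, and every partial sum containing that of index 1 is
nonpositive by `mul_sum_grunwaldWeight`. The tail sums are therefore at most `-(g_0 + g_1)`. -/
theorem summable_abs_grunwaldWeight {α : ℝ} (hα₁ : 1 < α) (hα₂ : α < 2) :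
    Summable fun k => |grunwaldWeight α k| := by
  have hα := ne_natCast_of_mem_Ioo hα₁ hα₂
  rw [← summable_nat_add_iff 2]
  have h0 := grunwaldWeight_add_two_nonneg hα₁ hα₂ hα
  simp only [abs_of_nonneg (h0 _)]
  refine summable_of_sum_range_le (c := -(1 + grunwaldWeight α 1)) h0 fun n => ?_
  have h := mul_sum_grunwaldWeight hα (n + 1)
  rw [Finset.sum_range_succ', Finset.sum_range_succ', grunwaldWeight_zero hα] at h
  have h2 : 0 ≤ ((n + 1 : ℕ) + 1 : ℝ) * grunwaldWeight α (n + 1 + 1) :=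
    mul_nonneg (by positivity) (h0 n)
  have h3 : α * (∑ k ∈ Finset.range n, grunwaldWeight α (k + 1 + 1)
      + grunwaldWeight α (0 + 1) + 1) ≤ 0 := by linarith
  have h4 := nonpos_of_mul_nonpos_right h3 (by linarith : 0 < α)
  simp only [zero_add, add_assoc, one_add_one_eq_two] at h4
  linarith

/-- The binomial series settles the open disc. A boundary point is reached radially: the series is
continuous in `r` by absolute summability, and the power is continuous because `Re (1 - w) ≥ 0` and
`α > 0`, even at `w = 1`. -/
theorem tsum_grunwaldWeight_mul_pow {α : ℝ} (hα₁ : 1 < α) (hα₂ : α < 2) {w : ℂ} (hw : ‖w‖ ≤ 1) :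
    ∑' k : ℕ, (grunwaldWeight α k : ℂ) * w ^ k = (1 - w) ^ (α : ℂ) := by
  have hα := ne_natCast_of_mem_Ioo hα₁ hα₂
  have hlt : ∀ w : ℂ, ‖w‖ < 1 →
      ∑' k : ℕ, (grunwaldWeight α k : ℂ) * w ^ k = (1 - w) ^ (α : ℂ) := by
    intro w hw
    have h := (Complex.one_add_cpow_hasFPowerSeriesOnBall_zero (a := (α : ℂ))).hasSum
      (y := -w) (by simpa [enorm_eq_nnnorm, ← NNReal.coe_lt_coe] using hw)
    rw [zero_add, ← sub_eq_add_neg] at h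
    rw [← h.tsum_eq]
    refine tsum_congr fun k => ?_
    rw [binomialSeries_apply, ofReal_grunwaldWeight hα]
    simp only [List.ofFn_const, List.prod_replicate, smul_eq_mul]
    rw [neg_pow w]
    ring
  have hmaps : ∀ r ∈ Ico (0 : ℝ) 1, ‖(r : ℂ) * w‖ < 1 := by
    intro r hr
    rw [norm_mul, Complex.norm_real, Real.norm_of_nonneg hr.1]
    exact (mul_le_of_le_one_right hr.1 hw).trans_lt hr.2
  have hL : ContinuousOn (fun r : ℝ => ∑' k : ℕ, (grunwaldWeight α k : ℂ) * ((r : ℂ) * w) ^ k)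
      (Icc 0 1) := by
    refine continuousOn_tsum (fun k => by fun_prop) (summable_abs_grunwaldWeight hα₁ hα₂)
      fun k r hr => ?_
    rw [norm_mul, Complex.norm_real, Real.norm_eq_abs, norm_pow]
    refine mul_le_of_le_one_right (abs_nonneg _) (pow_le_one₀ (norm_nonneg _) ?_)
    rw [norm_mul, Complex.norm_real, Real.norm_of_nonneg hr.1]
    exact mul_le_one₀ hr.2 (norm_nonneg _) hw
  have hR : ContinuousAt (fun r : ℝ => (1 - (r : ℂ) * w) ^ (α : ℂ)) 1 := by
    have h1 : ContinuousAt (fun x : ℂ => x ^ (α : ℂ)) (1 - ((1 : ℝ) : ℂ) * w) := by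
      refine Complex.continuousAt_cpow_const_of_re_pos (Or.inl ?_) ?_
      · have := (Complex.re_le_norm w).trans hw
        simpa using this
      · simp only [Complex.ofReal_re]; linarith
    exact ContinuousAt.comp (f := fun r : ℝ => 1 - (r : ℂ) * w) h1 (by fun_prop)
  have hL1 := (hL 1 (by simp)).mono_left (nhdsWithin_mono (1 : ℝ) Ico_subset_Icc_self)
  have hR1 := hR.continuousWithinAt (s := Ico 0 1)
  have hne : (𝓝[Ico (0 : ℝ) 1] 1).NeBot := by
    rw [← mem_closure_iff_nhdsWithin_neBot, closure_Ico zero_ne_one]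
    simp
  have heq := tendsto_nhds_unique_of_eventuallyEq hL1 hR1
    (by filter_upwards [self_mem_nhdsWithin] with r hr using hlt _ (hmaps r hr))
  simpa using heq

end GrunwaldWeights

/-! ### Taylor expansion of the symbols and the fifth order bound. -/

section Symbol

open Asymptotics Filter Topology

/-- `f z = a₀ + a₁ z + a₂ z² + a₃ z³ + a₄ z⁴ + O(z⁵)` as `z → 0`, `z ≠ 0`. -/
def HasQuarticExpansion (f : ℂ → ℂ) (a₀ a₁ a₂ a₃ a₄ : ℂ) : Prop :=
  (fun z => f z - (a₀ + a₁ * z + a₂ * z ^ 2 + a₃ * z ^ 3 + a₄ * z ^ 4))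
    =O[𝓝[≠] 0] fun z => z ^ 5

theorem isBigO_one_of_continuous {p : ℂ → ℂ} (hp : Continuous p) (l : Filter ℂ) (hl : l ≤ 𝓝 0) :
    p =O[l] fun _ => (1 : ℂ) :=
  ((hp.tendsto 0).isBigO_one ℂ).mono hl

theorem isBigO_pow_one (k : ℕ) : (fun z : ℂ => z ^ k) =O[𝓝[≠] 0] fun _ => (1 : ℂ) :=
  isBigO_one_of_continuous (by fun_prop) _ nhdsWithin_le_nhds

namespace HasQuarticExpansion

variable {f g : ℂ → ℂ} {a₀ a₁ a₂ a₃ a₄ b₀ b₁ b₂ b₃ b₄ : ℂ}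

theorem isBigO_one (hf : HasQuarticExpansion f a₀ a₁ a₂ a₃ a₄) :
    f =O[𝓝[≠] 0] fun _ => (1 : ℂ) := by
  have h1 := IsBigO.trans hf (isBigO_pow_one 5)
  have h2 : (fun z : ℂ => a₀ + a₁ * z + a₂ * z ^ 2 + a₃ * z ^ 3 + a₄ * z ^ 4)
      =O[𝓝[≠] 0] fun _ => (1 : ℂ) :=
    isBigO_one_of_continuous (by fun_prop) _ nhdsWithin_le_nhds
  simpa using h1.add h2

theorem const (c : ℂ) : HasQuarticExpansion (fun _ => c) c 0 0 0 0 := by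
  simp [HasQuarticExpansion, isBigO_zero]

theorem add (hf : HasQuarticExpansion f a₀ a₁ a₂ a₃ a₄)
    (hg : HasQuarticExpansion g b₀ b₁ b₂ b₃ b₄) :
    HasQuarticExpansion (fun z => f z + g z) (a₀ + b₀) (a₁ + b₁) (a₂ + b₂) (a₃ + b₃)
      (a₄ + b₄) := by
  refine (IsBigO.add hf hg).congr_left fun z => ?_
  ring

theorem const_mul (c : ℂ) (hf : HasQuarticExpansion f a₀ a₁ a₂ a₃ a₄) :
    HasQuarticExpansion (fun z => c * f z) (c * a₀) (c * a₁) (c * a₂) (c * a₃) (c * a₄) := by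
  refine (IsBigO.const_mul_left hf c).congr_left fun z => ?_
  ring

theorem mul (hf : HasQuarticExpansion f a₀ a₁ a₂ a₃ a₄)
    (hg : HasQuarticExpansion g b₀ b₁ b₂ b₃ b₄) :
    HasQuarticExpansion (fun z => f z * g z) (a₀ * b₀) (a₀ * b₁ + a₁ * b₀)
      (a₀ * b₂ + a₁ * b₁ + a₂ * b₀) (a₀ * b₃ + a₁ * b₂ + a₂ * b₁ + a₃ * b₀)
      (a₀ * b₄ + a₁ * b₃ + a₂ * b₂ + a₃ * b₁ + a₄ * b₀) := by
  have h1 := IsBigO.mul hf hg.isBigO_one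
  have h2 : (fun z : ℂ => a₀ + a₁ * z + a₂ * z ^ 2 + a₃ * z ^ 3 + a₄ * z ^ 4)
      =O[𝓝[≠] 0] fun _ => (1 : ℂ) :=
    isBigO_one_of_continuous (by fun_prop) _ nhdsWithin_le_nhds
  have h3 := h2.mul hg
  -- The terms of degree at least five in the product of the two polynomials, divided by `z ^ 5`.
  have h4 : (fun z : ℂ => (a₁ * b₄ + a₂ * b₃ + a₃ * b₂ + a₄ * b₁)
      + (a₂ * b₄ + a₃ * b₃ + a₄ * b₂) * z + (a₃ * b₄ + a₄ * b₃) * z ^ 2 + a₄ * b₄ * z ^ 3)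
      =O[𝓝[≠] 0] fun _ => (1 : ℂ) :=
    isBigO_one_of_continuous (by fun_prop) _ nhdsWithin_le_nhds
  have h5 := (isBigO_refl (fun z : ℂ => z ^ 5) (𝓝[≠] 0)).mul h4
  simp only [mul_one, one_mul] at h1 h3 h5
  refine ((h1.add h3).add h5).congr_left fun z => ?_
  ring

theorem isBigO_id (hf : HasQuarticExpansion f 0 a₁ a₂ a₃ a₄) : f =O[𝓝[≠] 0] fun z => z := by
  have h1 : (fun z : ℂ => z ^ 5) =O[𝓝[≠] 0] fun z => z := by
    simpa [pow_succ] using (isBigO_pow_one 4).mul (isBigO_refl (fun z : ℂ => z) (𝓝[≠] 0))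
  have h2 : (fun z : ℂ => a₁ + a₂ * z + a₃ * z ^ 2 + a₄ * z ^ 3)
      =O[𝓝[≠] 0] fun _ => (1 : ℂ) :=
    isBigO_one_of_continuous (by fun_prop) _ nhdsWithin_le_nhds
  have h3 := h2.mul (isBigO_refl (fun z : ℂ => z) (𝓝[≠] 0))
  simp only [one_mul] at h3
  refine ((IsBigO.trans hf h1).add h3).congr_left fun z => ?_
  ring

theorem tendsto_zero (hf : HasQuarticExpansion f 0 a₁ a₂ a₃ a₄) : Tendsto f (𝓝[≠] 0) (𝓝 0) :=
  hf.isBigO_id.trans_tendsto (tendsto_id.mono_left nhdsWithin_le_nhds)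

/-- Since `f = O(z)`, the binomial series in `f` truncated at degree four has remainder `O(f^5) =
O(z^5)`. The powers of `f` that remain are expanded by `mul`. -/
theorem one_add_cpow (a : ℂ) (hf : HasQuarticExpansion f 0 a₁ a₂ a₃ a₄) :
    HasQuarticExpansion (fun z => (1 + f z) ^ a) 1 (a * a₁)
      (a * a₂ + a * (a - 1) / 2 * a₁ ^ 2)
      (a * a₃ + a * (a - 1) * a₁ * a₂ + a * (a - 1) * (a - 2) / 6 * a₁ ^ 3)
      (a * a₄ + a * (a - 1) / 2 * (2 * a₁ * a₃ + a₂ ^ 2)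
        + a * (a - 1) * (a - 2) / 2 * a₁ ^ 2 * a₂
        + a * (a - 1) * (a - 2) * (a - 3) / 24 * a₁ ^ 4) := by
  have h1 := (Complex.one_add_cpow_hasFPowerSeriesAt_zero (a := a)).isBigO_sub_partialSum_pow 5
  have h2 := (h1.comp_tendsto hf.tendsto_zero).trans
    (((hf.isBigO_id.pow 5).norm_left).congr_left fun z => norm_pow _ _)
  have h3 : HasQuarticExpansion (fun z => (1 + f z) ^ a
      - (1 + a * f z + a * (a - 1) / 2 * (f z * f z)
        + a * (a - 1) * (a - 2) / 6 * (f z * (f z * f z))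
        + a * (a - 1) * (a - 2) * (a - 3) / 24 * (f z * (f z * (f z * f z))))) 0 0 0 0 0 := by
    refine h2.congr_left fun z => ?_
    have c1 := succ_mul_choose_succ a 0
    have c2 := succ_mul_choose_succ a 1
    have c3 := succ_mul_choose_succ a 2
    have c4 := succ_mul_choose_succ a 3
    have c0 := Ring.choose_zero_right a
    simp only [Nat.cast_zero, zero_add, Nat.reduceAdd, Nat.cast_one, Nat.cast_ofNat] at c1 c2 c3 c4
    simp only [Function.comp_def, FormalMultilinearSeries.partialSum, Finset.sum_range_succ,
      Finset.range_zero, Finset.sum_empty, binomialSeries_apply, List.ofFn_const,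
      List.prod_replicate, smul_eq_mul, zero_add]
    rw [show Ring.choose a 4 = a * (a - 1) * (a - 2) * (a - 3) / 24 by
        linear_combination c4 / 4 + (a - 3) / 12 * c3 + (a - 3) * (a - 2) / 24 * c2
          + (a - 3) * (a - 2) * (a - 1) / 24 * c1
          + (a - 3) * (a - 2) * (a - 1) * a / 24 * c0,
      show Ring.choose a 3 = a * (a - 1) * (a - 2) / 6 by
        linear_combination c3 / 3 + (a - 2) / 6 * c2 + (a - 2) * (a - 1) / 6 * c1
          + (a - 2) * (a - 1) * a / 6 * c0,
      show Ring.choose a 2 = a * (a - 1) / 2 by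
        linear_combination c2 / 2 + (a - 1) / 2 * c1 + (a - 1) * a / 2 * c0,
      show Ring.choose a 1 = a by linear_combination c1 + a * c0, c0]
    ring
  have hff := hf.mul hf
  have hfff := hf.mul hff
  have hffff := hf.mul hfff
  have h4 := h3.add (((((const 1).add (hf.const_mul a)).add (hff.const_mul (a * (a - 1) / 2))).add
    (hfff.const_mul (a * (a - 1) * (a - 2) / 6))).add
    (hffff.const_mul (a * (a - 1) * (a - 2) * (a - 3) / 24)))
  simp only [sub_add_cancel] at h4
  convert h4 using 1 <;> ring

theorem exp : HasQuarticExpansion Complex.exp 1 1 (1 / 2) (1 / 6) (1 / 24) := by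
  refine ((Complex.exp_sub_sum_range_isBigO_pow 5).mono nhdsWithin_le_nhds).congr_left fun z => ?_
  simp [Finset.sum_range_succ, Nat.factorial]
  ring

theorem exp_neg : HasQuarticExpansion (fun z => Complex.exp (-z)) 1 (-1) (1 / 2) (-1 / 6)
    (1 / 24) := by
  have h0 : Tendsto (fun z : ℂ => -z) (𝓝[≠] 0) (𝓝 0) :=
    (continuous_neg.tendsto' 0 0 neg_zero).mono_left nhdsWithin_le_nhds
  have h := (Complex.exp_sub_sum_range_isBigO_pow 5).comp_tendsto h0
  have h' : (fun z : ℂ => (-z) ^ 5) =O[𝓝[≠] 0] fun z => z ^ 5 :=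
    IsBigO.of_bound 1 (Eventually.of_forall fun z => by simp [norm_pow])
  refine (h.trans h').congr_left fun z => ?_
  simp [Finset.sum_range_succ, Nat.factorial]
  ring

theorem one_sub_exp_neg_div_sub_one :
    HasQuarticExpansion (fun z => (1 - Complex.exp (-z)) / z - 1) 0 (-1 / 2) (1 / 6) (-1 / 24)
      (1 / 120) := by
  have h0 : Tendsto (fun z : ℂ => -z) (𝓝[≠] 0) (𝓝 0) :=
    (continuous_neg.tendsto' 0 0 neg_zero).mono_left nhdsWithin_le_nhds
  -- Six terms of the exponential are needed, as the division by `z` costs one order.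
  have h := ((Complex.exp_sub_sum_range_isBigO_pow 6).comp_tendsto h0).mul
    (isBigO_refl (fun z : ℂ => z⁻¹) (𝓝[≠] 0))
  have h' : (fun z : ℂ => (-z) ^ 6 * z⁻¹) =O[𝓝[≠] 0] fun z => z ^ 5 := by
    refine IsBigO.of_bound 1 ?_
    filter_upwards [self_mem_nhdsWithin] with z hz
    have hz : z ≠ 0 := hz
    rw [show (-z) ^ 6 * z⁻¹ = z ^ 5 by field_simp, one_mul]
  refine ((h.trans h').neg_left).congr' ?_ EventuallyEq.rfl
  filter_upwards [self_mem_nhdsWithin] with z hz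
  have hz : z ≠ 0 := hz
  simp [Finset.sum_range_succ, Nat.factorial]
  field_simp
  ring

end HasQuarticExpansion

/-- The symbol of the quasi-compact operator. -/
noncomputable def quasiCompactSymbol (α : ℝ) (z : ℂ) : ℂ :=
  coeffM α * Complex.exp (-z) + 1 + coeffN α * Complex.exp z

/-- The symbol of the weighted sum of shifts on the difference side. -/
noncomputable def shiftSymbol (α : ℝ) (z : ℂ) : ℂ :=
  coeffMuOne α * Complex.exp z + coeffMuZero α + coeffMuNegOne α * Complex.exp (-z)

/-- The choice of the five coefficients enters only here: each Taylor coefficient of degree at most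
four becomes, once `coeffDen` is cleared, a polynomial identity in `α`. -/
theorem symbol_order_five {α : ℝ} (hden : coeffDen α ≠ 0) :
    (fun z : ℂ => quasiCompactSymbol α z
      - ((1 - Complex.exp (-z)) / z) ^ (α : ℂ) * shiftSymbol α z) =O[𝓝[≠] 0] fun z => z ^ 5 := by
  have hd : (coeffDen α : ℂ) ≠ 0 := by exact_mod_cast hden
  have hW := HasQuarticExpansion.one_sub_exp_neg_div_sub_one.one_add_cpow (α : ℂ)
  simp only [add_sub_cancel] at hW
  have hL := ((HasQuarticExpansion.exp_neg.const_mul (coeffM α)).add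
    (HasQuarticExpansion.const 1)).add (HasQuarticExpansion.exp.const_mul (coeffN α))
  have hR := ((HasQuarticExpansion.exp.const_mul (coeffMuOne α)).add
    (HasQuarticExpansion.const (coeffMuZero α))).add
    (HasQuarticExpansion.exp_neg.const_mul (coeffMuNegOne α))
  have h := hL.add ((hW.mul hR).const_mul (-1))
  have h' : HasQuarticExpansion (fun z : ℂ => quasiCompactSymbol α z
      - ((1 - Complex.exp (-z)) / z) ^ (α : ℂ) * shiftSymbol α z) 0 0 0 0 0 := by
    convert h using 1
    · funext z
      simp only [quasiCompactSymbol, shiftSymbol]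
      ring
    all_goals
      simp only [coeffM, coeffN, coeffMuOne, coeffMuZero, coeffMuNegOne]
      push_cast
      field_simp
      simp only [coeffDen]
      push_cast
      ring
  simpa [HasQuarticExpansion] using h'

/-- The arguments are at most `π/2` and strictly below `π/2` in absolute value, so their sum does
not cross the branch cut. The imaginary axis is allowed for `z`, as `λ = 0` requires. -/
theorem cpow_mul_cpow_of_re_nonneg {z w : ℂ} (hz : z ≠ 0) (hz' : 0 ≤ z.re) (hw : 0 < w.re)
    (a : ℂ) : (z * w) ^ a = z ^ a * w ^ a := by
  have hw0 : w ≠ 0 := by rintro rfl; simp at hw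
  have h1 := abs_le.1 (Complex.abs_arg_le_pi_div_two_iff.2 hz')
  have h2 := abs_lt.1 (Complex.abs_arg_lt_pi_div_two_iff.2 (Or.inl hw))
  rw [Complex.cpow_def_of_ne_zero (mul_ne_zero hz hw0), Complex.cpow_def_of_ne_zero hz,
    Complex.cpow_def_of_ne_zero hw0, Complex.log_mul hz hw0 ⟨by linarith, by linarith⟩,
    add_mul, Complex.exp_add]

theorem exists_symbol_bound {α : ℝ} (hα : 0 < α) (hden : coeffDen α ≠ 0) (R : ℝ) :
    ∃ C : ℝ, ∀ z : ℂ, 0 ≤ z.re → z.re ≤ R →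
      ‖z ^ (α : ℂ) * quasiCompactSymbol α z
        - (1 - Complex.exp (-z)) ^ (α : ℂ) * shiftSymbol α z‖ ≤ C * ‖z‖ ^ (5 + α) := by
  obtain ⟨c, hc⟩ := (symbol_order_five hden).bound
  -- The quotient tends to `1`, hence lies in the right half-plane near `0`, where `z^α` may be
  -- factored out of `(1 - e^{-z})^α`.
  have hre : ∀ᶠ z : ℂ in 𝓝[≠] 0, 0 < ((1 - Complex.exp (-z)) / z).re := by
    have h := HasQuarticExpansion.one_sub_exp_neg_div_sub_one.tendsto_zero
    have h2 := (Complex.continuous_re.tendsto _).comp h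
    filter_upwards [h2.eventually (lt_mem_nhds (show (-1 : ℝ) < (0 : ℂ).re by simp))] with z hz
    simp only [Function.comp_apply, Complex.sub_re, Complex.one_re] at hz
    linarith
  obtain ⟨δ, hδ, hball⟩ := Metric.mem_nhdsWithin_iff.1 (hc.and hre)
  set M : ℝ := (|coeffM α| + 1 + |coeffN α| * Real.exp R)
  set N : ℝ := (|coeffMuOne α| * Real.exp R + |coeffMuZero α| + |coeffMuNegOne α|)
  -- Inside the ball of radius `δ` the Taylor constant `c` serves. Outside it the symbols are
  -- bounded by `M` and `N` on the strip, and the missing powers are supplied by `‖z‖ / δ ≥ 1`.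
  refine ⟨max c (M / δ ^ 5 + 2 ^ α * N / δ ^ (5 + α)), fun z hz0 hzR => ?_⟩
  rcases eq_or_ne z 0 with rfl | hz
  · have h0 : (α : ℂ) ≠ 0 := by exact_mod_cast hα.ne'
    have : (0 : ℝ) ^ (5 + α) = 0 := Real.zero_rpow (by linarith)
    simp [h0, this]
  have hzpos : 0 < ‖z‖ := norm_pos_iff.2 hz
  have hsplit : ‖z‖ ^ (5 + α) = ‖z‖ ^ 5 * ‖z‖ ^ α := by
    rw [Real.rpow_add hzpos]; norm_cast
  rcases lt_or_ge ‖z‖ δ with hlt | hge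
  · obtain ⟨h1, h2⟩ := hball ⟨by simpa using hlt, hz⟩
    have hmul : (1 - Complex.exp (-z)) ^ (α : ℂ)
        = z ^ (α : ℂ) * ((1 - Complex.exp (-z)) / z) ^ (α : ℂ) := by
      rw [← cpow_mul_cpow_of_re_nonneg hz hz0 h2, mul_div_cancel₀ _ hz]
    rw [hmul, mul_assoc, ← mul_sub, norm_mul, Complex.norm_cpow_real, hsplit]
    rw [norm_pow] at h1
    calc ‖z‖ ^ α * _ ≤ ‖z‖ ^ α * (c * ‖z‖ ^ 5) := by gcongr
      _ = c * (‖z‖ ^ 5 * ‖z‖ ^ α) := by ring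
      _ ≤ _ := by gcongr; exact le_max_left _ _
  · have he1 : ‖Complex.exp (-z)‖ ≤ 1 := by
      rw [Complex.norm_exp]; simpa using hz0
    have he2 : ‖Complex.exp z‖ ≤ Real.exp R := by
      rw [Complex.norm_exp]; simpa using hzR
    have hQ : ‖quasiCompactSymbol α z‖ ≤ M := by
      refine (norm_add₃_le).trans ?_
      simp only [norm_mul, Complex.norm_real, Real.norm_eq_abs, norm_one, M]
      gcongr
      exact mul_le_of_le_one_right (abs_nonneg _) he1
    have hS : ‖shiftSymbol α z‖ ≤ N := by
      refine (norm_add₃_le).trans ?_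
      simp only [norm_mul, Complex.norm_real, Real.norm_eq_abs, N]
      gcongr
      exact mul_le_of_le_one_right (abs_nonneg _) he1
    have hM0 : 0 ≤ M := (norm_nonneg _).trans hQ
    have hN0 : 0 ≤ N := (norm_nonneg _).trans hS
    have hE : ‖1 - Complex.exp (-z)‖ ≤ 2 := by
      refine (norm_sub_le _ _).trans ?_
      rw [norm_one]; linarith
    have h5 : 1 ≤ ‖z‖ ^ 5 / δ ^ 5 := by
      rw [one_le_div (by positivity)]; gcongr
    have h6 : 1 ≤ ‖z‖ ^ (5 + α) / δ ^ (5 + α) := by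
      rw [one_le_div (by positivity)]; gcongr
    calc _ ≤ ‖z‖ ^ α * M + 2 ^ α * N := by
          refine (norm_sub_le _ _).trans ?_
          rw [norm_mul, norm_mul, Complex.norm_cpow_real, Complex.norm_cpow_real]
          gcongr
      _ ≤ ‖z‖ ^ α * M * (‖z‖ ^ 5 / δ ^ 5) + 2 ^ α * N * (‖z‖ ^ (5 + α) / δ ^ (5 + α)) := by
          exact add_le_add (le_mul_of_one_le_right (by positivity) h5)
            (le_mul_of_one_le_right (by positivity) h6)
      _ = (M / δ ^ 5 + 2 ^ α * N / δ ^ (5 + α)) * ‖z‖ ^ (5 + α) := by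
          rw [hsplit]; ring
      _ ≤ _ := by gcongr; exact le_max_right _ _

end Symbol

/-! ### Fourier integrals along vertical lines. -/

section FourierLaplace

open Filter Topology FourierTransform

/-- The point `λ + 2πiω` on the vertical line of abscissa `λ`. -/
noncomputable def verticalLine (lam ω : ℝ) : ℂ := lam + 2 * Real.pi * ω * Complex.I

@[simp]
theorem verticalLine_re (lam ω : ℝ) : (verticalLine lam ω).re = lam := by
  simp [verticalLine]

@[simp]
theorem verticalLine_im (lam ω : ℝ) : (verticalLine lam ω).im = 2 * Real.pi * ω := by
  simp [verticalLine]

theorem continuous_verticalLine (lam : ℝ) : Continuous (verticalLine lam) := by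
  unfold verticalLine
  fun_prop

theorem abs_le_norm_verticalLine (lam ω : ℝ) : |ω| ≤ ‖verticalLine lam ω‖ := by
  have h := Complex.abs_im_le_norm (verticalLine lam ω)
  rw [verticalLine_im, abs_mul, abs_of_pos Real.two_pi_pos] at h
  have h2 : 1 ≤ 2 * Real.pi := by linarith [Real.two_le_pi]
  nlinarith [abs_nonneg ω]

theorem norm_verticalLine_le (lam ω : ℝ) :
    ‖verticalLine lam ω‖ ≤ (|lam| + 2 * Real.pi) * (1 + |ω|) := by
  have h := Complex.norm_le_abs_re_add_abs_im (verticalLine lam ω)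
  rw [verticalLine_re, verticalLine_im, abs_mul, abs_of_pos Real.two_pi_pos] at h
  nlinarith [abs_nonneg ω, abs_nonneg lam, Real.two_pi_pos, mul_nonneg (abs_nonneg lam)
    (abs_nonneg ω)]

/-- Negative exponents arise from the fractional integral, whose multiplier is `s^{α-2}`. For `λ =
0` it is singular at `ω = 0`, integrably because `γ > -1`. -/
theorem integrable_norm_rpow_mul_one_add_norm_rpow {γ r : ℝ} (hγ : -1 < γ) (hγ0 : γ ≤ 0)
    (hr : 1 < r) : Integrable (fun ω : ℝ => |ω| ^ γ * (1 + |ω|) ^ (-r)) := by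
  have hmeas : Measurable fun ω : ℝ => |ω| ^ γ := by fun_prop
  have hloc : LocallyIntegrable (fun ω : ℝ => |ω| ^ γ) volume := by
    refine locallyIntegrable_of_norm_le_rpow (C := 1) (α := -γ) (by simp) (by simp; linarith) ?_
      hmeas.aestronglyMeasurable
    refine Eventually.of_forall fun ω => ?_
    rw [neg_neg, one_mul, Real.norm_of_nonneg (by positivity), Real.norm_eq_abs]
  have h1 : Integrable ((Icc (-1 : ℝ) 1).indicator fun ω => |ω| ^ γ) :=
    (integrable_indicator_iff measurableSet_Icc).2 (hloc.integrableOn_isCompact isCompact_Icc)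
  have h2 : Integrable fun ω : ℝ => (1 + ‖ω‖) ^ (-r) := integrable_one_add_norm (by simpa)
  refine (h1.add h2).mono' (by fun_prop) (Eventually.of_forall fun ω => ?_)
  rw [Real.norm_of_nonneg (by positivity), Pi.add_apply, Real.norm_eq_abs]
  have hle : (1 + |ω|) ^ (-r) ≤ 1 :=
    Real.rpow_le_one_of_one_le_of_nonpos (by linarith [abs_nonneg ω]) (by linarith)
  by_cases hω : ω ∈ Icc (-1 : ℝ) 1
  · rw [indicator_of_mem hω]
    have h3 : |ω| ^ γ * (1 + |ω|) ^ (-r) ≤ |ω| ^ γ := mul_le_of_le_one_right (by positivity) hle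
    have h4 : 0 ≤ (1 + |ω|) ^ (-r) := by positivity
    linarith
  · rw [indicator_of_notMem hω, zero_add]
    have h1 : 1 ≤ |ω| := by
      by_contra! hlt
      exact hω (abs_le.1 hlt.le)
    exact mul_le_of_le_one_left (by positivity) (Real.rpow_le_one_of_one_le_of_nonpos h1 hγ0)

/-- For `γ ≤ 0` the bound `|ω| ≤ |s|` reduces to a power singularity at `0`. For `γ ≥ 0` the growth
`|s| ≤ c (1 + |ω|)` is absorbed by the decay of `φ`. -/
theorem integrable_norm_verticalLine_rpow_mul {φ : ℝ → ℂ} {C r : ℝ} (hφ : Continuous φ)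
    (hdecay : ∀ ω, ‖φ ω‖ ≤ C * (1 + |ω|) ^ (-r)) (hr : 1 < r) (lam : ℝ) {γ : ℝ} (hγ : -1 < γ)
    (hγr : γ + 1 < r) :
    Integrable (fun ω : ℝ => ‖verticalLine lam ω‖ ^ γ * ‖φ ω‖) := by
  have hmeas : AEStronglyMeasurable (fun ω : ℝ => ‖verticalLine lam ω‖ ^ γ * ‖φ ω‖) := by
    have := (continuous_verticalLine lam).measurable
    have := hφ.measurable
    fun_prop
  rcases le_total γ 0 with h0 | h0
  · refine ((integrable_norm_rpow_mul_one_add_norm_rpow hγ h0 hr).const_mul C).mono' hmeas ?_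
    filter_upwards [compl_mem_ae_iff.2 (measure_singleton (0 : ℝ))] with ω hω
    have hω : 0 < |ω| := abs_pos.2 hω
    rw [Real.norm_of_nonneg (by positivity)]
    calc _ ≤ |ω| ^ γ * (C * (1 + |ω|) ^ (-r)) := by
          exact mul_le_mul (Real.rpow_le_rpow_of_nonpos hω (abs_le_norm_verticalLine lam ω) h0)
            (hdecay ω) (norm_nonneg _) (by positivity)
      _ = _ := by ring
  · have h2 : Integrable fun ω : ℝ => (1 + ‖ω‖) ^ (-(r - γ)) :=
      integrable_one_add_norm (by simp; linarith)
    refine (h2.const_mul ((|lam| + 2 * Real.pi) ^ γ * C)).mono' hmeas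
      (Eventually.of_forall fun ω => ?_)
    have hp : 0 < 1 + |ω| := by positivity
    have hpi := Real.pi_pos
    rw [Real.norm_of_nonneg (by positivity), Real.norm_eq_abs]
    calc _ ≤ ((|lam| + 2 * Real.pi) * (1 + |ω|)) ^ γ * (C * (1 + |ω|) ^ (-r)) := by
          gcongr
          · exact norm_verticalLine_le lam ω
          · exact hdecay ω
      _ = _ := by
          rw [Real.mul_rpow (by positivity) hp.le, show -(r - γ) = γ + -r by ring,
            Real.rpow_add hp]
          ring

theorem integrable_verticalLine_cpow_mul {φ : ℝ → ℂ} {C r : ℝ} (hφ : Continuous φ)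
    (hdecay : ∀ ω, ‖φ ω‖ ≤ C * (1 + |ω|) ^ (-r)) (hr : 1 < r) (lam : ℝ) {γ : ℝ} (hγ : -1 < γ)
    (hγr : γ + 1 < r) :
    Integrable (fun ω : ℝ => verticalLine lam ω ^ (γ : ℂ) * φ ω) := by
  refine (integrable_norm_verticalLine_rpow_mul hφ hdecay hr lam hγ hγr).mono' ?_
    (Eventually.of_forall fun ω => ?_)
  · have := (continuous_verticalLine lam).measurable
    have := hφ.measurable
    fun_prop
  · rw [norm_mul, Complex.norm_cpow_real]

/-- The inverse Laplace-type integral `x ↦ ∫ e^{(λ + 2πiω) x} f(ω) dω`. -/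
noncomputable def lineTransform (lam : ℝ) (f : ℝ → ℂ) (x : ℝ) : ℂ :=
  ∫ ω, Complex.exp (verticalLine lam ω * x) * f ω

theorem norm_exp_verticalLine_mul (lam ω x : ℝ) :
    ‖Complex.exp (verticalLine lam ω * x)‖ = Real.exp (lam * x) := by
  rw [Complex.norm_exp]; simp

theorem integrable_exp_verticalLine_mul {f : ℝ → ℂ} (hf : Integrable f) (lam x : ℝ) :
    Integrable fun ω => Complex.exp (verticalLine lam ω * x) * f ω := by
  refine hf.bdd_mul (c := Real.exp (lam * x)) ?_ ?_
  · have := continuous_verticalLine lam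
    exact Continuous.aestronglyMeasurable (by fun_prop)
  · exact Eventually.of_forall fun ω => (norm_exp_verticalLine_mul lam ω x).le

theorem lineTransform_eq (lam : ℝ) (f : ℝ → ℂ) (x : ℝ) :
    lineTransform lam f x = Complex.exp (lam * x) * lineTransform 0 f x := by
  rw [lineTransform, lineTransform, ← integral_const_mul]
  refine integral_congr_ae (Eventually.of_forall fun ω => ?_)
  simp only
  rw [← mul_assoc, ← Complex.exp_add]
  congr 2
  simp [verticalLine]
  ring

theorem norm_lineTransform_zero_le (f : ℝ → ℂ) (x : ℝ) : ‖lineTransform 0 f x‖ ≤ ∫ ω, ‖f ω‖ := by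
  refine (norm_integral_le_integral_norm _).trans (le_of_eq ?_)
  refine integral_congr_ae (Eventually.of_forall fun ω => ?_)
  simp only
  rw [norm_mul, norm_exp_verticalLine_mul]
  simp

theorem hasDerivAt_lineTransform {lam : ℝ} {f : ℝ → ℂ} (hf : Integrable f)
    (hf' : Integrable fun ω => verticalLine lam ω * f ω) (x : ℝ) :
    HasDerivAt (lineTransform lam f) (lineTransform lam (fun ω => verticalLine lam ω * f ω) x)
      x := by
  have key := hasDerivAt_integral_of_dominated_loc_of_deriv_le (μ := volume) (x₀ := x)
    (F := fun y ω => Complex.exp (verticalLine lam ω * (y : ℝ)) * f ω)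
    (F' := fun y ω => Complex.exp (verticalLine lam ω * (y : ℝ)) * (verticalLine lam ω * f ω))
    (bound := fun ω => Real.exp (|lam| * (|x| + 1)) * ‖verticalLine lam ω * f ω‖)
    (s := Metric.ball x 1) (Metric.ball_mem_nhds x one_pos)
    (Eventually.of_forall fun y => (integrable_exp_verticalLine_mul hf lam y).1)
    (integrable_exp_verticalLine_mul hf lam x)
    (integrable_exp_verticalLine_mul hf' lam x).1
    (Eventually.of_forall fun ω y hy => ?_)
    (hf'.norm.const_mul _)
    (Eventually.of_forall fun ω y hy => ?_)
  · exact key.2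
  · rw [norm_mul, norm_exp_verticalLine_mul]
    refine mul_le_mul_of_nonneg_right (Real.exp_le_exp.2 ?_) (norm_nonneg _)
    have h1 : |y| ≤ |x| + 1 := by
      have := abs_sub_abs_le_abs_sub y x
      have h2 : |y - x| < 1 := by simpa [Real.dist_eq] using hy
      linarith
    calc lam * y ≤ |lam * y| := le_abs_self _
      _ = |lam| * |y| := abs_mul _ _
      _ ≤ _ := by gcongr
  · have h1 : HasDerivAt (fun y : ℝ => verticalLine lam ω * (y : ℂ)) (verticalLine lam ω) y := by
      simpa using (Complex.ofRealCLM.hasDerivAt (x := y)).const_mul (verticalLine lam ω)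
    have h2 := h1.cexp.mul_const (f ω)
    rwa [mul_assoc] at h2

/-- The transforms of `u` and of its `n`-th derivative are bounded by `L¹` norms. The two bounds
combine through `(1 + |ω|)^n ≤ 2^(n-1) (1 + |ω|^n)`. -/
theorem exists_fourier_decay {u : ℝ → ℝ} {n : ℕ} (hu : ContDiff ℝ n u)
    (hL1 : ∀ k : ℕ, k ≤ n → Integrable (iteratedDeriv k u) volume) :
    ∃ C : ℝ, ∀ ω, ‖𝓕 (fun x => (u x : ℂ)) ω‖ ≤ C * (1 + |ω|) ^ (-(n : ℝ)) := by
  have hder : ∀ k : ℕ, k ≤ n → iteratedDeriv k (fun x => (u x : ℂ))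
      = fun x => ((iteratedDeriv k u x : ℝ) : ℂ) := by
    intro k
    induction k with
    | zero => intro _; simp
    | succ k ih =>
      intro hk
      rw [iteratedDeriv_succ, ih (by omega)]
      funext x
      have hd : DifferentiableAt ℝ (iteratedDeriv k u) x :=
        (hu.differentiable_iteratedDeriv k (by exact_mod_cast hk)) x
      rw [iteratedDeriv_succ]
      exact hd.hasDerivAt.ofReal_comp.deriv
  have hint : ∀ k : ℕ, k ≤ n → Integrable (iteratedDeriv k fun x => (u x : ℂ)) := by
    intro k hk
    rw [hder k hk]
    exact (hL1 k hk).ofReal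
  have hU : ContDiff ℝ ((n : ℕ∞) : WithTop ℕ∞) fun x => (u x : ℂ) :=
    Complex.ofRealCLM.contDiff.comp hu
  have hF := Real.fourier_iteratedDeriv hU (fun k hk => hint k (by exact_mod_cast hk)) (n := n)
    le_rfl
  set A := ∫ x, ‖(u x : ℂ)‖
  set B := ∫ x, ‖iteratedDeriv n (fun x => (u x : ℂ)) x‖
  have hA : ∀ ω, ‖𝓕 (fun x => (u x : ℂ)) ω‖ ≤ A := fun ω =>
    VectorFourier.norm_fourierIntegral_le_integral_norm _ _ _ _ _
  have hB : ∀ ω, |ω| ^ n * ‖𝓕 (fun x => (u x : ℂ)) ω‖ ≤ B := by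
    intro ω
    have h1 : ‖𝓕 (iteratedDeriv n (fun x => (u x : ℂ))) ω‖ ≤ B :=
      VectorFourier.norm_fourierIntegral_le_integral_norm _ _ _ _ _
    rw [hF] at h1
    simp only [norm_smul, norm_pow] at h1
    refine le_trans ?_ h1
    gcongr
    have h2 := abs_le_norm_verticalLine 0 ω
    rw [verticalLine] at h2
    simpa [mul_assoc, mul_comm, mul_left_comm] using h2
  refine ⟨2 ^ (n - 1) * (A + B), fun ω => ?_⟩
  have hp : 0 < 1 + |ω| := by positivity
  rw [Real.rpow_neg hp.le, Real.rpow_natCast, ← div_eq_mul_inv, le_div_iff₀ (by positivity)]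
  have h3 : (1 + |ω|) ^ n ≤ 2 ^ (n - 1) * (1 ^ n + |ω| ^ n) :=
    add_pow_le zero_le_one (abs_nonneg ω) n
  calc _ ≤ ‖𝓕 (fun x => (u x : ℂ)) ω‖ * (2 ^ (n - 1) * (1 ^ n + |ω| ^ n)) := by gcongr
    _ = 2 ^ (n - 1) * (‖𝓕 (fun x => (u x : ℂ)) ω‖ + |ω| ^ n * ‖𝓕 (fun x => (u x : ℂ)) ω‖) := by
      ring
    _ ≤ _ := by gcongr; exacts [hA ω, hB ω]

theorem lineTransform_fourier {u : ℝ → ℝ} (hu : Continuous u) (hint : Integrable u)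
    (hF : Integrable (𝓕 fun x => (u x : ℂ))) (x : ℝ) :
    lineTransform 0 (𝓕 fun x => (u x : ℂ)) x = u x := by
  have h := (Complex.continuous_ofReal.comp hu).fourierInv_fourier_eq hint.ofReal hF
  have h2 := congrFun h x
  simp only [Function.comp_apply] at h2
  rw [← h2, Real.fourierInv_eq', lineTransform]
  refine integral_congr_ae (Eventually.of_forall fun ω => ?_)
  simp only [smul_eq_mul, Function.comp_def]
  congr 2
  simp [verticalLine]
  ring

end FourierLaplace

/-! ### Fractional integrals of Fourier integrals. -/

section SingularIntegral

open Filter Topology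

theorem integrableOn_rpow_mul_exp_neg_mul {a b : ℝ} (ha : -1 < a) (hb : 0 < b) :
    IntegrableOn (fun t : ℝ => t ^ a * Real.exp (-b * t)) (Ioi 0) := by
  simpa using integrableOn_rpow_mul_exp_neg_mul_rpow (p := 1) ha one_pos hb

/-- Both sides are holomorphic on the right half-plane and agree on the positive reals by the Gamma
integral, so the identity theorem applies. -/
theorem integral_rpow_mul_cexp_neg_mul {β : ℝ} (hβ : 0 < β) {z : ℂ} (hz : 0 < z.re) :
    ∫ t in Ioi (0 : ℝ), ((t ^ (β - 1) : ℝ) : ℂ) * Complex.exp (-z * t)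
      = Real.Gamma β * z ^ (-(β : ℂ)) := by
  have hmeas : ∀ (a : ℝ) (w : ℂ), AEStronglyMeasurable
      (fun t : ℝ => ((t ^ a : ℝ) : ℂ) * Complex.exp (-w * t)) (volume.restrict (Ioi 0)) := by
    intro a w
    exact Measurable.aestronglyMeasurable (by fun_prop)
  have hnorm : ∀ (a : ℝ) (w : ℂ) (t : ℝ), 0 < t →
      ‖((t ^ a : ℝ) : ℂ) * Complex.exp (-w * t)‖ = t ^ a * Real.exp (-w.re * t) := by
    intro a w t ht
    rw [norm_mul, Complex.norm_real, Real.norm_of_nonneg (by positivity), Complex.norm_exp]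
    simp
  set U : Set ℂ := {w | 0 < w.re}
  have hU : IsOpen U := isOpen_lt continuous_const Complex.continuous_re
  have hG : DifferentiableOn ℂ (fun w : ℂ => ∫ t in Ioi (0 : ℝ),
      ((t ^ (β - 1) : ℝ) : ℂ) * Complex.exp (-w * t)) U := by
    intro w hw
    have hw : 0 < w.re := hw
    refine (DifferentiableAt.differentiableWithinAt ?_)
    have key := hasDerivAt_integral_of_dominated_loc_of_deriv_le
      (μ := volume.restrict (Ioi (0 : ℝ))) (x₀ := w)
      (F := fun w t => ((t ^ (β - 1) : ℝ) : ℂ) * Complex.exp (-w * (t : ℝ)))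
      (F' := fun w t => -(((t ^ β : ℝ) : ℂ) * Complex.exp (-w * (t : ℝ))))
      (bound := fun t => t ^ β * Real.exp (-(w.re / 2) * t))
      -- On this ball real parts stay above `w.re / 2`, which gives an integrable bound independent
      -- of the point.
      (s := Metric.ball w (w.re / 2)) (Metric.ball_mem_nhds w (by positivity))
      (Eventually.of_forall fun y => hmeas _ y) ?_ (hmeas _ _).neg ?_
      (integrableOn_rpow_mul_exp_neg_mul (by linarith) (by positivity)) ?_
    · exact key.2.differentiableAt
    · refine (integrableOn_rpow_mul_exp_neg_mul (a := β - 1) (by linarith) hw).mono' (hmeas _ _) ?_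
      filter_upwards [ae_restrict_mem measurableSet_Ioi] with t ht
      exact (hnorm _ _ t ht).le
    · filter_upwards [ae_restrict_mem measurableSet_Ioi] with t ht y hy
      have ht : 0 < t := ht
      rw [norm_neg, hnorm _ _ t ht]
      gcongr
      have h1 := (Complex.abs_re_le_norm (y - w)).trans_lt (by simpa [dist_eq_norm] using hy)
      rw [Complex.sub_re] at h1
      linarith [(abs_lt.1 h1).1]
    · filter_upwards [ae_restrict_mem measurableSet_Ioi] with t ht y hy
      have ht : 0 < t := ht
      have h1 : HasDerivAt (fun y : ℂ => -y * (t : ℂ)) (-t) y := by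
        simpa using ((hasDerivAt_id y).neg.mul_const (t : ℂ))
      refine (h1.cexp.const_mul ((t ^ (β - 1) : ℝ) : ℂ)).congr_deriv ?_
      rw [show β = β - 1 + 1 by ring, Real.rpow_add_one ht.ne']
      push_cast
      ring_nf
  have hH : DifferentiableOn ℂ (fun w : ℂ => (Real.Gamma β : ℂ) * w ^ (-(β : ℂ))) U := by
    intro w hw
    refine DifferentiableAt.differentiableWithinAt ?_
    exact (differentiableAt_id.cpow_const (Or.inl hw)).const_mul _
  have hreal : ∀ r : ℝ, 0 < r → ∫ t in Ioi (0 : ℝ), ((t ^ (β - 1) : ℝ) : ℂ) *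
      Complex.exp (-(r : ℂ) * t) = (Real.Gamma β : ℂ) * (r : ℂ) ^ (-(β : ℂ)) := by
    intro r hr
    have h := Real.integral_rpow_mul_exp_neg_mul_Ioi hβ hr
    have h2 : ∫ t in Ioi (0 : ℝ), ((t ^ (β - 1) : ℝ) : ℂ) * Complex.exp (-(r : ℂ) * t)
        = ((∫ t in Ioi (0 : ℝ), t ^ (β - 1) * Real.exp (-(r * t)) : ℝ) : ℂ) := by
      rw [← integral_complex_ofReal]
      refine integral_congr_ae (Eventually.of_forall fun t => ?_)
      simp
    rw [h2, h, one_div, Real.inv_rpow hr.le, ← Real.rpow_neg hr.le]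
    push_cast
    rw [Complex.ofReal_cpow hr.le]
    push_cast
    ring
  have hfreq : ∃ᶠ w : ℂ in 𝓝[≠] (1 : ℂ), (∫ t in Ioi (0 : ℝ), ((t ^ (β - 1) : ℝ) : ℂ) *
      Complex.exp (-w * t)) = (Real.Gamma β : ℂ) * w ^ (-(β : ℂ)) := by
    have ht : Tendsto (fun r : ℝ => (r : ℂ)) (𝓝[≠] 1) (𝓝[≠] (1 : ℂ)) := by
      refine tendsto_nhdsWithin_iff.2 ⟨?_, ?_⟩
      · exact (Complex.continuous_ofReal.tendsto' 1 1 (by simp)).mono_left nhdsWithin_le_nhds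
      · filter_upwards [self_mem_nhdsWithin] with r hr
        simpa using hr
    refine ht.frequently (Eventually.frequently ?_)
    filter_upwards [nhdsWithin_le_nhds (lt_mem_nhds one_pos)] with r hr using hreal r hr
  exact AnalyticOnNhd.eqOn_of_preconnected_of_frequently_eq (hG.analyticOnNhd hU)
    (hH.analyticOnNhd hU) (convex_halfSpace_re_gt 0).isPreconnected
    (show (1 : ℂ) ∈ U by simp [U]) hfreq hz

/-- On `(0, 1]` the kernel is integrable and `g` bounded; beyond `1` the kernel is at most `1` and
`g` integrable. -/
theorem integrableOn_rpow_sub_one_mul {g : ℝ → ℝ} {β B : ℝ} (hβ : 0 < β) (hβ1 : β ≤ 1)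
    (hg : IntegrableOn g (Ioi 0)) (hB : ∀ t, 0 < t → |g t| ≤ B) :
    IntegrableOn (fun t : ℝ => t ^ (β - 1) * g t) (Ioi 0) := by
  have hmeas : AEStronglyMeasurable (fun t : ℝ => t ^ (β - 1)) (volume.restrict (Ioi 0)) :=
    Measurable.aestronglyMeasurable (by fun_prop)
  rw [← Ioc_union_Ioi_eq_Ioi (zero_le_one (α := ℝ)), integrableOn_union]
  constructor
  · have h1 : IntegrableOn (fun t : ℝ => t ^ (β - 1)) (Ioc 0 1) :=
      (intervalIntegrable_iff_integrableOn_Ioc_of_le zero_le_one).1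
        (intervalIntegral.intervalIntegrable_rpow' (by linarith))
    refine Integrable.mul_bdd (c := B) h1 (hg.mono_set Ioc_subset_Ioi_self).1 ?_
    filter_upwards [ae_restrict_mem measurableSet_Ioc] with t ht
    exact hB t ht.1
  · have hsub : Ioi (1 : ℝ) ⊆ Ioi 0 := Ioi_subset_Ioi zero_le_one
    refine Integrable.bdd_mul (c := 1) (hg.mono_set hsub) (hmeas.mono_set hsub) ?_
    filter_upwards [ae_restrict_mem measurableSet_Ioi] with t ht
    have ht : 1 < t := ht
    rw [Real.norm_of_nonneg (by positivity)]
    exact Real.rpow_le_one_of_one_le_of_nonpos ht.le (by linarith)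

/-- Damped version of the formula for the fractional integral of a Fourier integral. -/
theorem integral_rpow_mul_lineTransform_of_pos {φ : ℝ → ℂ} (hφ : Integrable φ) {β : ℝ}
    (hβ : 0 < β) {μ : ℝ} (hμ : 0 < μ) (x : ℝ) :
    ∫ t in Ioi (0 : ℝ), ((t ^ (β - 1) * Real.exp (-μ * t) : ℝ) : ℂ) * lineTransform 0 φ (x - t)
      = Real.Gamma β * lineTransform 0 (fun ω => verticalLine μ ω ^ (-(β : ℂ)) * φ ω) x := by
  have hk : IntegrableOn (fun t : ℝ => ((t ^ (β - 1) * Real.exp (-μ * t) : ℝ) : ℂ)) (Ioi 0) :=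
    (integrableOn_rpow_mul_exp_neg_mul (by linarith) hμ).ofReal
  -- Damping makes the kernel integrable on the half-line, which is what Fubini needs.
  have hprod : Integrable (fun p : ℝ × ℝ => ((p.1 ^ (β - 1) * Real.exp (-μ * p.1) : ℝ) : ℂ)
      * (Complex.exp (verticalLine 0 p.2 * (x - p.1 : ℝ)) * φ p.2))
      ((volume.restrict (Ioi (0 : ℝ))).prod volume) := by
    have h := (hk.integrable.mul_prod hφ).bdd_mul (c := 1)
      (f := fun p : ℝ × ℝ => Complex.exp (verticalLine 0 p.2 * (x - p.1 : ℝ))) ?_ ?_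
    · refine h.congr (Eventually.of_forall fun p => ?_)
      simp only
      ring
    · have := continuous_verticalLine 0
      exact Continuous.aestronglyMeasurable (by fun_prop)
    · refine Eventually.of_forall fun p => ?_
      rw [norm_exp_verticalLine_mul]
      simp
  simp only [lineTransform]
  simp_rw [← integral_const_mul]
  rw [integral_integral_swap hprod]
  refine integral_congr_ae (Eventually.of_forall fun ω => ?_)
  simp only
  have h := integral_rpow_mul_cexp_neg_mul hβ (z := verticalLine μ ω) (by simpa using hμ)
  calc _ = ∫ t in Ioi (0 : ℝ), (Complex.exp (verticalLine 0 ω * x) * φ ω)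
        * (((t ^ (β - 1) : ℝ) : ℂ) * Complex.exp (-verticalLine μ ω * t)) := by
        refine integral_congr_ae (Eventually.of_forall fun t => ?_)
        have : Complex.exp (verticalLine 0 ω * (x - t : ℝ)) * Complex.exp (-μ * t)
            = Complex.exp (verticalLine 0 ω * x) * Complex.exp (-verticalLine μ ω * t) := by
          rw [← Complex.exp_add, ← Complex.exp_add]
          congr 1
          simp [verticalLine]
          ring
        simp only [Complex.ofReal_mul, Complex.ofReal_exp, Complex.ofReal_neg]
        linear_combination ((t ^ (β - 1) : ℝ) : ℂ) * φ ω * this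
    _ = _ := by
        rw [integral_const_mul, h]
        ring

/-- The damped formula with `μ = λ + ε` passes to the limit `ε → 0⁺`, so that `λ = 0` is covered.
The undamped integrand dominates on the left; on the right `|2πω|^{-β} |φ|` does, because `|s| ≥
|2πω|`. -/
theorem integral_rpow_mul_lineTransform {φ : ℝ → ℂ} (hφ : Integrable φ) {β : ℝ}
    (hβ : 0 < β) {lam : ℝ} (hlam : 0 ≤ lam)
    (hφβ : Integrable fun ω => ‖verticalLine 0 ω‖ ^ (-β) * ‖φ ω‖) (x : ℝ)
    (hint : IntegrableOn (fun t => ((t ^ (β - 1) : ℝ) : ℂ) * lineTransform 0 φ (x - t)) (Ioi 0)) :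
    ∫ t in Ioi (0 : ℝ), ((t ^ (β - 1) * Real.exp (-lam * t) : ℝ) : ℂ) * lineTransform 0 φ (x - t)
      = Real.Gamma β * lineTransform 0 (fun ω => verticalLine lam ω ^ (-(β : ℂ)) * φ ω) x := by
  have hL : Tendsto (fun ε : ℝ => ∫ t in Ioi (0 : ℝ),
      ((t ^ (β - 1) * Real.exp (-(lam + ε) * t) : ℝ) : ℂ) * lineTransform 0 φ (x - t)) (𝓝[>] 0)
      (𝓝 (∫ t in Ioi (0 : ℝ),
        ((t ^ (β - 1) * Real.exp (-lam * t) : ℝ) : ℂ) * lineTransform 0 φ (x - t))) := by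
    refine tendsto_integral_filter_of_dominated_convergence
      (fun t => ‖((t ^ (β - 1) : ℝ) : ℂ) * lineTransform 0 φ (x - t)‖) ?_ ?_ hint.norm ?_
    · refine Eventually.of_forall fun ε => ?_
      have h1 : AEStronglyMeasurable (fun t : ℝ => ((Real.exp (-(lam + ε) * t) : ℝ) : ℂ))
          (volume.restrict (Ioi 0)) := Continuous.aestronglyMeasurable (by fun_prop)
      refine (h1.mul hint.1).congr (Eventually.of_forall fun t => ?_)
      simp only [Pi.mul_apply]
      push_cast
      ring
    · filter_upwards [self_mem_nhdsWithin] with ε hε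
      have hε : 0 < ε := hε
      filter_upwards [ae_restrict_mem measurableSet_Ioi] with t ht
      have ht : 0 < t := ht
      rw [norm_mul, norm_mul]
      gcongr
      rw [Complex.norm_real, Complex.norm_real, norm_mul]
      refine mul_le_of_le_one_right (norm_nonneg _) ?_
      rw [Real.norm_of_nonneg (Real.exp_pos _).le, Real.exp_le_one_iff]
      nlinarith
    · refine Eventually.of_forall fun t => ?_
      refine Tendsto.mono_left ?_ nhdsWithin_le_nhds
      refine Continuous.tendsto' (by fun_prop) _ _ (by simp)
  have hR : Tendsto (fun ε : ℝ => (Real.Gamma β : ℂ) *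
      lineTransform 0 (fun ω => verticalLine (lam + ε) ω ^ (-(β : ℂ)) * φ ω) x) (𝓝[>] 0)
      (𝓝 (Real.Gamma β * lineTransform 0 (fun ω => verticalLine lam ω ^ (-(β : ℂ)) * φ ω) x)) := by
    refine Tendsto.const_mul _ ?_
    refine tendsto_integral_filter_of_dominated_convergence
      (fun ω => ‖verticalLine 0 ω‖ ^ (-β) * ‖φ ω‖) ?_ ?_ hφβ ?_
    · refine Eventually.of_forall fun ε => ?_
      have h1 := continuous_verticalLine 0
      have h2 := (continuous_verticalLine (lam + ε)).measurable
      have h3 : AEStronglyMeasurable fun ω => Complex.exp (verticalLine 0 ω * x) :=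
        Continuous.aestronglyMeasurable (by fun_prop)
      have h4 : AEStronglyMeasurable fun ω => verticalLine (lam + ε) ω ^ (-(β : ℂ)) :=
        Measurable.aestronglyMeasurable (by fun_prop)
      exact h3.mul (h4.mul hφ.1)
    · filter_upwards [self_mem_nhdsWithin] with ε hε
      filter_upwards [compl_mem_ae_iff.2 (measure_singleton (0 : ℝ))] with ω hω
      have hω : 0 < |ω| := abs_pos.2 hω
      rw [norm_mul, norm_exp_verticalLine_mul, norm_mul, ← Complex.ofReal_neg,
        Complex.norm_cpow_real]
      simp only [zero_mul, Real.exp_zero, one_mul]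
      gcongr ?_ * _
      refine Real.rpow_le_rpow_of_nonpos (hω.trans_le (abs_le_norm_verticalLine 0 ω)) ?_
        (by linarith)
      have h5 := Complex.abs_im_le_norm (verticalLine (lam + ε) ω)
      have h6 : ‖verticalLine 0 ω‖ = |(verticalLine (lam + ε) ω).im| := by
        rw [verticalLine_im]
        simp [verticalLine, abs_of_pos Real.pi_pos]
      rwa [h6]
    · filter_upwards [compl_mem_ae_iff.2 (measure_singleton (0 : ℝ))] with ω hω
      have hω : ω ≠ 0 := hω
      refine Tendsto.const_mul _ (Tendsto.mul_const _ ?_)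
      -- Off the null set `ω = 0` the line avoids the branch cut, even for `λ = 0`.
      have h1 : verticalLine lam ω ∈ Complex.slitPlane := by
        refine Or.inr ?_
        rw [verticalLine_im]
        exact mul_ne_zero Real.two_pi_pos.ne' hω
      have h2 : Tendsto (fun ε : ℝ => verticalLine (lam + ε) ω) (𝓝[>] 0)
          (𝓝 (verticalLine lam ω)) := by
        refine Tendsto.mono_left ?_ nhdsWithin_le_nhds
        unfold verticalLine
        exact Continuous.tendsto' (by fun_prop) _ _ (by simp)
      exact h2.cpow tendsto_const_nhds h1
  refine tendsto_nhds_unique_of_eventuallyEq hL hR ?_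
  filter_upwards [self_mem_nhdsWithin] with ε hε
  have hε : 0 < ε := hε
  exact integral_rpow_mul_lineTransform_of_pos hφ hβ (by linarith) x

end SingularIntegral

/-! ### The tempered derivative and the Grünwald operators as multipliers. -/

section Operators

open Filter Topology

theorem integrableOn_Iio_iff_comp_sub_left (F : ℝ → ℝ) (x : ℝ) :
    IntegrableOn F (Iio x) ↔ IntegrableOn (fun t => F (x - t)) (Ioi 0) := by
  have h := (Measure.measurePreserving_sub_left (volume : Measure ℝ) x).integrableOn_comp_preimage
    (MeasurableEquiv.subLeft x).measurableEmbedding (f := F) (s := Iio x)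
  rw [← h]
  simp [Function.comp_def]

theorem setIntegral_Iio_eq_comp_sub_left (F : ℝ → ℝ) (x : ℝ) :
    ∫ s in Iio x, F s = ∫ t in Ioi (0 : ℝ), F (x - t) := by
  have h := (Measure.measurePreserving_sub_left (volume : Measure ℝ) x).setIntegral_preimage_emb
    (MeasurableEquiv.subLeft x).measurableEmbedding F (Iio x)
  rw [← h]
  simp

theorem natCeil_eq_two {α : ℝ} (hα₁ : 1 < α) (hα₂ : α < 2) : ⌈α⌉₊ = 2 := by
  rw [Nat.ceil_eq_iff (by norm_num)]
  constructor <;> norm_num <;> linarith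

theorem integrableOn_rpow_mul_comp_sub {u : ℝ → ℝ} (hu : Integrable u) {B : ℝ}
    (hB : ∀ x, |u x| ≤ B) {β : ℝ} (hβ : 0 < β) (hβ1 : β ≤ 1) {lam : ℝ} (hlam : 0 ≤ lam) (x : ℝ) :
    IntegrableOn (fun t => t ^ (β - 1) * (Real.exp (lam * (x - t)) * u (x - t))) (Ioi 0) := by
  have hexp : ∀ t : ℝ, 0 < t → Real.exp (lam * (x - t)) ≤ Real.exp (lam * x) := fun t ht =>
    Real.exp_le_exp.2 (by nlinarith)
  refine integrableOn_rpow_sub_one_mul (B := Real.exp (lam * x) * B) hβ hβ1 ?_ ?_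
  · refine Integrable.bdd_mul (c := Real.exp (lam * x)) (hu.comp_sub_left x).integrableOn
      (Continuous.aestronglyMeasurable (by fun_prop)) ?_
    filter_upwards [ae_restrict_mem measurableSet_Ioi] with t ht
    rw [Real.norm_of_nonneg (Real.exp_pos _).le]
    exact hexp t ht
  · intro t ht
    rw [abs_mul, abs_of_pos (Real.exp_pos _)]
    exact mul_le_mul (hexp t ht) (hB _) (abs_nonneg _) (Real.exp_pos _).le

theorem self_mul_cpow (z : ℂ) {a : ℝ} (ha : -1 < a) : z * z ^ (a : ℂ) = z ^ ((a + 1 : ℝ) : ℂ) := by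
  rcases eq_or_ne z 0 with rfl | hz
  · have h : ((a + 1 : ℝ) : ℂ) ≠ 0 := by exact_mod_cast (by linarith : a + 1 ≠ 0)
    rw [zero_mul, Complex.zero_cpow h]
  · push_cast
    rw [Complex.cpow_add _ _ hz, Complex.cpow_one, mul_comm]

theorem lineTransform_add {lam : ℝ} {f g : ℝ → ℂ} (hf : Integrable f) (hg : Integrable g) (x : ℝ) :
    lineTransform lam (f + g) x = lineTransform lam f x + lineTransform lam g x := by
  simp only [lineTransform, Pi.add_apply, mul_add]
  exact integral_add (integrable_exp_verticalLine_mul hf lam x)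
    (integrable_exp_verticalLine_mul hg lam x)

theorem lineTransform_const_mul (lam : ℝ) (c : ℂ) (f : ℝ → ℂ) (x : ℝ) :
    lineTransform lam (fun ω => c * f ω) x = c * lineTransform lam f x := by
  simp only [lineTransform]
  rw [← integral_const_mul]
  congr 1 with ω
  ring

theorem exp_mul_lineTransform_zero_add (lam : ℝ) (f : ℝ → ℂ) (x y : ℝ) :
    Complex.exp (lam * y) * lineTransform 0 f (x + y)
      = lineTransform 0 (fun ω => Complex.exp (verticalLine lam ω * y) * f ω) x := by
  simp only [lineTransform]
  rw [← integral_const_mul]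
  congr 1 with ω
  rw [← mul_assoc, ← mul_assoc, ← Complex.exp_add, ← Complex.exp_add]
  congr 2
  simp [verticalLine]
  ring

section Decay

variable {u : ℝ → ℝ} {φ : ℝ → ℂ} {C r : ℝ}

theorem hasDerivAt_lineTransform_cpow (hφ : Continuous φ)
    (hdecay : ∀ ω, ‖φ ω‖ ≤ C * (1 + |ω|) ^ (-r)) (hr : 1 < r) (lam : ℝ) {γ : ℝ} (hγ : -1 < γ)
    (hγr : γ + 2 < r) (x : ℝ) :
    HasDerivAt (lineTransform lam fun ω => verticalLine lam ω ^ (γ : ℂ) * φ ω)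
      (lineTransform lam (fun ω => verticalLine lam ω ^ ((γ + 1 : ℝ) : ℂ) * φ ω) x) x := by
  have heq : (fun ω => verticalLine lam ω * (verticalLine lam ω ^ (γ : ℂ) * φ ω))
      = fun ω => verticalLine lam ω ^ ((γ + 1 : ℝ) : ℂ) * φ ω := by
    funext ω
    rw [← mul_assoc, self_mul_cpow _ hγ]
  have h1 := integrable_verticalLine_cpow_mul hφ hdecay hr lam hγ (by linarith)
  have h2 := integrable_verticalLine_cpow_mul hφ hdecay hr lam (γ := γ + 1) (by linarith)
    (by linarith)
  have h := hasDerivAt_lineTransform h1 (by rwa [heq]) x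
  rwa [heq] at h

theorem integrable_of_decay (hφ : Continuous φ)
    (hdecay : ∀ ω, ‖φ ω‖ ≤ C * (1 + |ω|) ^ (-r)) (hr : 1 < r) : Integrable φ := by
  simpa using integrable_verticalLine_cpow_mul hφ hdecay hr 0 (γ := 0) (by norm_num) (by linarith)

/-- After `s = x - t` the weight splits as `e^{λx} e^{-λt}`: the second factor damps the kernel with
`β = 2 - α`, the first moves the transform to the line of abscissa `λ`. -/
theorem ofReal_leftSingularIntegral {α lam : ℝ} (hα₁ : 1 < α) (hα₂ : α < 2) (hlam : 0 ≤ lam)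
    (hu : Integrable u) (hφ : Continuous φ) (hdecay : ∀ ω, ‖φ ω‖ ≤ C * (1 + |ω|) ^ (-r))
    (hr : 1 < r) (hrep : ∀ x, lineTransform 0 φ x = u x) (x : ℝ) :
    (leftSingularIntegral α (fun s => Real.exp (lam * s) * u s) x : ℂ)
      = Real.Gamma (2 - α)
        * lineTransform lam (fun ω => verticalLine lam ω ^ ((α - 2 : ℝ) : ℂ) * φ ω) x := by
  have hφi := integrable_of_decay hφ hdecay hr
  have hB : ∀ x, |u x| ≤ ∫ ω, ‖φ ω‖ := fun x => by
    rw [← Real.norm_eq_abs, ← Complex.norm_real, ← hrep]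
    exact norm_lineTransform_zero_le φ x
  have hβ : 0 < 2 - α := by linarith
  have hint : IntegrableOn (fun t => ((t ^ (2 - α - 1) : ℝ) : ℂ) * lineTransform 0 φ (x - t))
      (Ioi 0) := by
    have h := (integrableOn_rpow_mul_comp_sub hu hB hβ (by linarith) le_rfl x).ofReal (𝕜 := ℂ)
    refine h.congr (Eventually.of_forall fun t => ?_)
    simp [hrep]
  have h := integral_rpow_mul_lineTransform hφi hβ hlam
    (integrable_norm_verticalLine_rpow_mul hφ hdecay hr 0 (by linarith) (by linarith))
    x hint
  rw [lineTransform_eq, mul_left_comm, ← show -((2 - α : ℝ) : ℂ) = ((α - 2 : ℝ) : ℂ) by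
    push_cast; ring, ← h, leftSingularIntegral, setIntegral_Iio_eq_comp_sub_left,
    ← integral_complex_ofReal, ← integral_const_mul, natCeil_eq_two hα₁ hα₂]
  refine integral_congr_ae (Eventually.of_forall fun t => ?_)
  simp only [hrep, sub_sub_cancel, Nat.cast_ofNat]
  have he : Real.exp (lam * (x - t)) = Real.exp (lam * x) * Real.exp (-lam * t) := by
    rw [← Real.exp_add]; congr 1; ring
  rw [he]
  push_cast
  ring

theorem hasDerivAt_re_lineTransform_cpow (hφ : Continuous φ)
    (hdecay : ∀ ω, ‖φ ω‖ ≤ C * (1 + |ω|) ^ (-r)) (hr : 1 < r) (lam : ℝ) {γ : ℝ} (hγ : -1 < γ)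
    (hγr : γ + 2 < r) (x : ℝ) :
    HasDerivAt (fun x => (lineTransform lam (fun ω => verticalLine lam ω ^ (γ : ℂ) * φ ω) x).re)
      (lineTransform lam (fun ω => verticalLine lam ω ^ ((γ + 1 : ℝ) : ℂ) * φ ω) x).re x :=
  Complex.reCLM.hasFDerivAt.comp_hasDerivAt x
    (hasDerivAt_lineTransform_cpow hφ hdecay hr lam hγ hγr x)

theorem deriv_leftSingularIntegral {α lam : ℝ} (hα₁ : 1 < α) (hα₂ : α < 2) (hlam : 0 ≤ lam)
    (hu : Integrable u) (hφ : Continuous φ) (hdecay : ∀ ω, ‖φ ω‖ ≤ C * (1 + |ω|) ^ (-r))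
    (hr : α + 3 < r) (hrep : ∀ x, lineTransform 0 φ x = u x) :
    ContDiff ℝ 2 (leftSingularIntegral α (fun s => Real.exp (lam * s) * u s)) ∧
    iteratedDeriv 2 (leftSingularIntegral α (fun s => Real.exp (lam * s) * u s))
      = fun x => Real.Gamma (2 - α)
        * (lineTransform lam (fun ω => verticalLine lam ω ^ (α : ℂ) * φ ω) x).re := by
  set R : ℝ → ℝ → ℝ := fun γ x =>
    (lineTransform lam (fun ω => verticalLine lam ω ^ (γ : ℂ) * φ ω) x).re with hR
  have hJ : leftSingularIntegral α (fun s => Real.exp (lam * s) * u s)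
      = fun x => Real.Gamma (2 - α) * R (α - 2) x := by
    funext x
    have h := congrArg Complex.re
      (ofReal_leftSingularIntegral hα₁ hα₂ hlam hu hφ hdecay (by linarith) hrep x)
    rwa [Complex.ofReal_re, Complex.re_ofReal_mul] at h
  have hd : ∀ γ δ : ℝ, -1 < γ → γ + 2 < r → γ + 1 = δ → ∀ x,
      HasDerivAt (fun x => Real.Gamma (2 - α) * R γ x) (Real.Gamma (2 - α) * R δ x) x := by
    rintro γ _ hγ hγr rfl x
    exact (hasDerivAt_re_lineTransform_cpow hφ hdecay (by linarith) lam hγ hγr x).const_mul _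
  have h0 := hd (α - 2) (α - 1) (by linarith) (by linarith) (by ring)
  have h1 := hd (α - 1) α (by linarith) (by linarith) (by ring)
  -- Each derivative raises the exponent of `s` by one. This third step serves only to make the
  -- second derivative continuous.
  have h2 := hd α (α + 1) (by linarith) (by linarith) rfl
  have hderiv0 : deriv (fun x => Real.Gamma (2 - α) * R (α - 2) x)
      = fun x => Real.Gamma (2 - α) * R (α - 1) x := funext fun x => (h0 x).deriv
  have hderiv1 : deriv (fun x => Real.Gamma (2 - α) * R (α - 1) x)
      = fun x => Real.Gamma (2 - α) * R α x := funext fun x => (h1 x).deriv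
  rw [hJ]
  constructor
  · rw [show (2 : WithTop ℕ∞) = 1 + 1 by norm_num, contDiff_succ_iff_deriv, hderiv0,
      contDiff_one_iff_deriv, hderiv1]
    exact ⟨fun x => (h0 x).differentiableAt, by simp, fun x => (h1 x).differentiableAt,
      continuous_iff_continuousAt.2 fun x => (h2 x).continuousAt⟩
  · rw [iteratedDeriv_succ, iteratedDeriv_one, hderiv0, hderiv1]

theorem leftTemperedDeriv_eq {α lam : ℝ} (hα₁ : 1 < α) (hα₂ : α < 2) (hlam : 0 ≤ lam)
    (hu : Integrable u) (hφ : Continuous φ) (hdecay : ∀ ω, ‖φ ω‖ ≤ C * (1 + |ω|) ^ (-r))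
    (hr : α + 3 < r) (hrep : ∀ x, lineTransform 0 φ x = u x) (x : ℝ) :
    leftTemperedDeriv α lam u x
      = (lineTransform 0 (fun ω => verticalLine lam ω ^ (α : ℂ) * φ ω) x).re := by
  have hG : Real.Gamma (2 - α) ≠ 0 := (Real.Gamma_pos_of_pos (by linarith)).ne'
  have h := (deriv_leftSingularIntegral hα₁ hα₂ hlam hu hφ hdecay hr hrep).2
  rw [leftTemperedDeriv, leftRLDeriv, natCeil_eq_two hα₁ hα₂, h]
  beta_reduce
  rw [lineTransform_eq lam, ← Complex.ofReal_mul, ← Complex.ofReal_exp, Complex.re_ofReal_mul]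
  have he : Real.exp (-lam * x) * Real.exp (lam * x) = 1 := by
    rw [← Real.exp_add]; simp
  push_cast
  have hc := one_div_mul_cancel hG
  linear_combination (lineTransform 0 (fun ω => verticalLine lam ω ^ (α : ℂ) * φ ω) x).re
    * (he + Real.exp (-lam * x) * Real.exp (lam * x) * hc)

/-- The `k`-th term has multiplier `g_k e^{psh} e^{-ksh}`. As `λ ≥ 0` gives `|e^{-sh}| ≤ 1`,
summability of `|g_k|` allows sum and integral to be exchanged, and the binomial series sums the
multipliers. -/
theorem hasSum_temperedGrunwaldTerm {α lam h : ℝ} (hα₁ : 1 < α) (hα₂ : α < 2) (hlam : 0 ≤ lam)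
    (hh : 0 < h) (hφ : Integrable φ) (hrep : ∀ x, lineTransform 0 φ x = u x) (p : ℤ) (x : ℝ) :
    HasSum (fun k => (temperedGrunwaldTerm α lam p h u x k : ℂ))
      (lineTransform 0 (fun ω => Complex.exp (verticalLine lam ω * (p * h : ℝ))
        * ((1 - Complex.exp (-(verticalLine lam ω * h))) ^ (α : ℂ) * φ ω)) x) := by
  have hle : ∀ ω, ‖Complex.exp (-(verticalLine lam ω * h))‖ ≤ 1 := by
    intro ω
    rw [Complex.norm_exp, Real.exp_le_one_iff]
    simp only [Complex.neg_re, Complex.re_mul_ofReal, verticalLine_re]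
    nlinarith
  set G : ℕ → ℝ → ℂ := fun k ω => Complex.exp (verticalLine 0 ω * x)
    * (Complex.exp (verticalLine lam ω * (p * h : ℝ))
      * ((grunwaldWeight α k * Complex.exp (-(verticalLine lam ω * h)) ^ k) * φ ω)) with hG
  have hterm : ∀ k, (temperedGrunwaldTerm α lam p h u x k : ℂ) = ∫ ω, G k ω := by
    intro k
    rw [temperedGrunwaldTerm]
    push_cast
    rw [← hrep, lineTransform, ← integral_const_mul]
    congr 1 with ω
    have he : Complex.exp (-((k : ℂ) - p) * lam * h)
        * Complex.exp (verticalLine 0 ω * ((x - ((k : ℝ) - p) * h : ℝ) : ℂ))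
        = Complex.exp (verticalLine 0 ω * x) * (Complex.exp (verticalLine lam ω * (p * h : ℝ))
          * Complex.exp (-(verticalLine lam ω * h)) ^ k) := by
      rw [← Complex.exp_nat_mul, ← Complex.exp_add, ← Complex.exp_add, ← Complex.exp_add]
      congr 1
      simp [verticalLine]
      ring
    simp only [hG]
    linear_combination (grunwaldWeight α k : ℂ) * φ ω * he
  have hmeas : ∀ k, AEStronglyMeasurable fun ω : ℝ =>
      (grunwaldWeight α k : ℂ) * Complex.exp (-(verticalLine lam ω * h)) ^ k := fun k => by
    have := continuous_verticalLine lam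
    exact Continuous.aestronglyMeasurable (by fun_prop)
  have hwt : ∀ k ω, ‖(grunwaldWeight α k : ℂ) * Complex.exp (-(verticalLine lam ω * h)) ^ k‖
      ≤ |grunwaldWeight α k| := by
    intro k ω
    rw [norm_mul, norm_pow, Complex.norm_real, Real.norm_eq_abs]
    exact mul_le_of_le_one_right (abs_nonneg _) (pow_le_one₀ (norm_nonneg _) (hle ω))
  have hGint : ∀ k, Integrable (G k) := fun k =>
    integrable_exp_verticalLine_mul (integrable_exp_verticalLine_mul
      (hφ.bdd_mul (hmeas k) (Eventually.of_forall (hwt k))) _ _) _ _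
  have hGnorm : ∀ k, ∫ ω, ‖G k ω‖
      ≤ |grunwaldWeight α k| * (Real.exp (lam * (p * h)) * ∫ ω, ‖φ ω‖) := by
    intro k
    rw [← integral_const_mul, ← integral_const_mul]
    refine integral_mono (hGint k).norm ((hφ.norm.const_mul _).const_mul _) fun ω => ?_
    simp only [hG]
    rw [norm_mul, norm_mul, norm_mul _ (φ ω), norm_exp_verticalLine_mul,
      norm_exp_verticalLine_mul, zero_mul, Real.exp_zero, one_mul, mul_left_comm]
    gcongr
    exact hwt k ω
  have hsum := hasSum_integral_of_summable_integral_norm hGint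
    (Summable.of_nonneg_of_le (fun k => integral_nonneg fun ω => norm_nonneg _) hGnorm
      ((summable_abs_grunwaldWeight hα₁ hα₂).mul_right _))
  simp only [← hterm] at hsum
  have hval : ∫ ω, ∑' k, G k ω = lineTransform 0
      (fun ω => Complex.exp (verticalLine lam ω * (p * h : ℝ))
        * ((1 - Complex.exp (-(verticalLine lam ω * h))) ^ (α : ℂ) * φ ω)) x := by
    rw [lineTransform]
    congr 1 with ω
    simp only [hG]
    rw [tsum_mul_left, tsum_mul_left, tsum_mul_right, tsum_grunwaldWeight_mul_pow hα₁ hα₂ (hle ω)]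
  rwa [hval] at hsum

end Decay

end Operators

/-! ### The truncation error and its bound. -/

section Consistency

open Filter Topology FourierTransform

/-- The symbol of the truncation error at the frequency `s`. -/
noncomputable def errorSymbol (α h : ℝ) (s : ℂ) : ℂ :=
  quasiCompactSymbol α (s * h) * s ^ (α : ℂ)
    - ((1 / h ^ α : ℝ) : ℂ) * (shiftSymbol α (s * h) * (1 - Complex.exp (-(s * h))) ^ (α : ℂ))

theorem exists_errorSymbol_bound {α : ℝ} (hα : 0 < α) (hden : coeffDen α ≠ 0) {lam : ℝ}
    (hlam : 0 ≤ lam) :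
    ∃ C : ℝ, ∀ h : ℝ, 0 < h → h ≤ 1 → ∀ ω,
      ‖errorSymbol α h (verticalLine lam ω)‖ ≤ C * h ^ 5 * ‖verticalLine lam ω‖ ^ (5 + α) := by
  -- For `h ≤ 1` the point `s h` has real part `λ h ≤ λ`, so the strip of width `λ` suffices for all
  -- such `h`.
  obtain ⟨C, hC⟩ := exists_symbol_bound hα hden lam
  refine ⟨C, fun h hh hh1 ω => ?_⟩
  set s := verticalLine lam ω with hs
  have hre : s.re = lam := verticalLine_re lam ω
  have hb := hC (s * h) (by rw [Complex.re_mul_ofReal, hre]; positivity)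
    (by rw [Complex.re_mul_ofReal, hre]; nlinarith)
  have hcpow : (s * h) ^ (α : ℂ) = s ^ (α : ℂ) * ((h ^ α : ℝ) : ℂ) := by
    rcases eq_or_ne s 0 with h0 | h0
    · have : (α : ℂ) ≠ 0 := by exact_mod_cast hα.ne'
      rw [h0, zero_mul, Complex.zero_cpow this, zero_mul]
    · rw [cpow_mul_cpow_of_re_nonneg h0 (by rw [hre]; exact hlam) (by simpa using hh),
        Complex.ofReal_cpow hh.le]
  have hpos : 0 < h ^ α := Real.rpow_pos_of_pos hh α
  have hne : ((h ^ α : ℝ) : ℂ) ≠ 0 := by exact_mod_cast hpos.ne'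
  have heq : errorSymbol α h s = ((1 / h ^ α : ℝ) : ℂ) * ((s * h) ^ (α : ℂ)
      * quasiCompactSymbol α (s * h) - (1 - Complex.exp (-(s * h))) ^ (α : ℂ)
      * shiftSymbol α (s * h)) := by
    rw [errorSymbol, hcpow]
    push_cast
    field_simp
  rw [heq, norm_mul, Complex.norm_real, Real.norm_of_nonneg (by positivity)]
  -- The factor `h^{-α}` cancels against `h^{5+α}` and leaves `h^5`.
  calc _ ≤ 1 / h ^ α * (C * ‖s * h‖ ^ (5 + α)) := by gcongr
    _ = _ := by
      rw [norm_mul, Complex.norm_real, Real.norm_of_nonneg hh.le,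
        Real.mul_rpow (norm_nonneg _) hh.le, Real.rpow_add hh]
      norm_cast
      field_simp

variable {u : ℝ → ℝ} {φ : ℝ → ℂ} {C r : ℝ}

theorem temperedGrunwald_eq {α lam h : ℝ} (hα₁ : 1 < α) (hα₂ : α < 2) (hlam : 0 ≤ lam)
    (hh : 0 < h) (hφ : Integrable φ) (hrep : ∀ x, lineTransform 0 φ x = u x) (p : ℤ) (x : ℝ) :
    temperedGrunwald α lam p h u x = (((1 / h ^ α : ℝ) : ℂ) *
      lineTransform 0 (fun ω => Complex.exp (verticalLine lam ω * (p * h : ℝ))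
        * ((1 - Complex.exp (-(verticalLine lam ω * h))) ^ (α : ℂ) * φ ω)) x).re := by
  rw [← (hasSum_temperedGrunwaldTerm hα₁ hα₂ hlam hh hφ hrep p x).tsum_eq, ← Complex.ofReal_tsum,
    Complex.re_ofReal_mul, Complex.ofReal_re, temperedGrunwald]

theorem truncationError_eq {α lam h : ℝ} (hα₁ : 1 < α) (hα₂ : α < 2) (hlam : 0 ≤ lam)
    (hh : 0 < h) (hu : Integrable u) (hφ : Continuous φ)
    (hdecay : ∀ ω, ‖φ ω‖ ≤ C * (1 + |ω|) ^ (-r)) (hr : α + 3 < r)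
    (hrep : ∀ x, lineTransform 0 φ x = u x) (x : ℝ) :
    quasiCompactOp α lam h (leftTemperedDeriv α lam u) x
        - (coeffMuOne α * temperedGrunwald α lam 1 h u x
          + coeffMuZero α * temperedGrunwald α lam 0 h u x
          + coeffMuNegOne α * temperedGrunwald α lam (-1) h u x)
      = (lineTransform 0 (fun ω => errorSymbol α h (verticalLine lam ω) * φ ω) x).re := by
  have hφi := integrable_of_decay hφ hdecay (by linarith)
  set f : ℝ → ℂ := fun ω => verticalLine lam ω ^ (α : ℂ) * φ ω with hf
  set g : ℝ → ℂ := fun ω => (1 - Complex.exp (-(verticalLine lam ω * h))) ^ (α : ℂ) * φ ω with hg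
  have hfi : Integrable f :=
    integrable_verticalLine_cpow_mul hφ hdecay (by linarith) lam (by linarith) (by linarith)
  have hgi : Integrable g := by
    refine hφi.bdd_mul (c := 2 ^ α) ?_ (Eventually.of_forall fun ω => ?_)
    · have := (continuous_verticalLine lam).measurable
      exact Measurable.aestronglyMeasurable (by fun_prop)
    · rw [Complex.norm_cpow_real]
      gcongr
      refine (norm_sub_le _ _).trans ?_
      have h1 : ‖Complex.exp (-(verticalLine lam ω * h))‖ ≤ 1 := by
        rw [Complex.norm_exp, Real.exp_le_one_iff]
        simp only [Complex.neg_re, Complex.re_mul_ofReal, verticalLine_re]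
        nlinarith
      rw [norm_one]
      linarith
  have hfe := fun y => integrable_exp_verticalLine_mul hfi lam y
  have hge := fun y => integrable_exp_verticalLine_mul hgi lam y
  have hsplit : lineTransform 0 (fun ω => errorSymbol α h (verticalLine lam ω) * φ ω) x
      = (coeffM α : ℂ) * lineTransform 0
          (fun ω => Complex.exp (verticalLine lam ω * (-h : ℝ)) * f ω) x
        + lineTransform 0 f x
        + (coeffN α : ℂ) * lineTransform 0
          (fun ω => Complex.exp (verticalLine lam ω * h) * f ω) x
        + ((-(coeffMuOne α * (1 / h ^ α)) : ℝ) : ℂ) * lineTransform 0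
          (fun ω => Complex.exp (verticalLine lam ω * (((1 : ℤ) : ℝ) * h : ℝ)) * g ω) x
        + ((-(coeffMuZero α * (1 / h ^ α)) : ℝ) : ℂ) * lineTransform 0
          (fun ω => Complex.exp (verticalLine lam ω * (((0 : ℤ) : ℝ) * h : ℝ)) * g ω) x
        + ((-(coeffMuNegOne α * (1 / h ^ α)) : ℝ) : ℂ) * lineTransform 0
          (fun ω => Complex.exp (verticalLine lam ω * (((-1 : ℤ) : ℝ) * h : ℝ)) * g ω) x := by
    simp only [← lineTransform_const_mul]
    have i1 := (hfe (-h)).const_mul (coeffM α : ℂ)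
    have i2 := (hfe h).const_mul (coeffN α : ℂ)
    have j := fun (c : ℂ) y => (hge y).const_mul c
    rw [← lineTransform_add i1 hfi, ← lineTransform_add (i1.add hfi) i2,
      ← lineTransform_add ((i1.add hfi).add i2) (j _ _),
      ← lineTransform_add (((i1.add hfi).add i2).add (j _ _)) (j _ _),
      ← lineTransform_add ((((i1.add hfi).add i2).add (j _ _)).add (j _ _)) (j _ _)]
    congr 1 with ω
    simp only [Pi.add_apply, errorSymbol, quasiCompactSymbol, shiftSymbol, hf, hg]
    push_cast
    simp only [one_mul, zero_mul, mul_zero, Complex.exp_zero, mul_neg, neg_mul]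
    ring
  have hD : ∀ (c y : ℝ), c * Real.exp (lam * y) * leftTemperedDeriv α lam u (x + y)
      = ((c : ℂ) * lineTransform 0
        (fun ω => Complex.exp (verticalLine lam ω * y) * f ω) x).re := by
    intro c y
    rw [← exp_mul_lineTransform_zero_add, ← Complex.ofReal_mul, ← Complex.ofReal_exp,
      Complex.re_ofReal_mul, Complex.re_ofReal_mul,
      leftTemperedDeriv_eq hα₁ hα₂ hlam hu hφ hdecay hr hrep, mul_assoc]
  have hD1 := hD (coeffM α) (-h)
  have hD2 := hD (coeffN α) h
  rw [mul_neg, ← neg_mul, ← sub_eq_add_neg] at hD1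
  rw [hsplit, quasiCompactOp, hD1, hD2,
    leftTemperedDeriv_eq hα₁ hα₂ hlam hu hφ hdecay hr hrep x,
    temperedGrunwald_eq hα₁ hα₂ hlam hh hφi hrep, temperedGrunwald_eq hα₁ hα₂ hlam hh hφi hrep,
    temperedGrunwald_eq hα₁ hα₂ hlam hh hφi hrep]
  simp only [Complex.add_re, Complex.re_ofReal_mul]
  ring

/-- The constant is an integral of `|s|^{5+α} |φ|`, finite since `5 + α - r < -1`, and free of `x`
because the exponential on the line of abscissa `0` has modulus one. -/
theorem exists_truncationError_bound {α lam : ℝ} (hα₁ : 1 < α) (hα₂ : α < 2) (hlam : 0 ≤ lam)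
    (hden : coeffDen α ≠ 0) (hu : Integrable u) (hφ : Continuous φ)
    (hdecay : ∀ ω, ‖φ ω‖ ≤ C * (1 + |ω|) ^ (-r)) (hr : α + 6 < r)
    (hrep : ∀ x, lineTransform 0 φ x = u x) :
    ∃ K : ℝ, ∀ h : ℝ, 0 < h → h ≤ 1 → ∀ x : ℝ,
      |quasiCompactOp α lam h (leftTemperedDeriv α lam u) x
        - (coeffMuOne α * temperedGrunwald α lam 1 h u x
          + coeffMuZero α * temperedGrunwald α lam 0 h u x
          + coeffMuNegOne α * temperedGrunwald α lam (-1) h u x)| ≤ K * h ^ 5 := by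
  obtain ⟨K, hK⟩ := exists_errorSymbol_bound (by linarith) hden hlam
  have hint := integrable_norm_verticalLine_rpow_mul hφ hdecay (by linarith) lam (γ := 5 + α)
    (by linarith) (by linarith)
  refine ⟨K * ∫ ω, ‖verticalLine lam ω‖ ^ (5 + α) * ‖φ ω‖, fun h hh hh1 x => ?_⟩
  rw [truncationError_eq hα₁ hα₂ hlam hh hu hφ hdecay (by linarith) hrep]
  refine (Complex.abs_re_le_norm _).trans ((norm_lineTransform_zero_le _ _).trans ?_)
  rw [mul_right_comm, ← integral_const_mul]
  refine integral_mono_of_nonneg (Eventually.of_forall fun ω => norm_nonneg _)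
    (hint.const_mul _) (Eventually.of_forall fun ω => ?_)
  simp only
  rw [norm_mul, ← mul_assoc]
  gcongr
  exact hK h hh hh1 ω

end Consistency

theorem mainTheorem9 (α lam : ℝ) (hα₁ : 1 < α) (hα₂ : α < 2) (hlam : 0 ≤ lam)
    (hden : coeffDen α ≠ 0)
    (u : ℝ → ℝ) (hu : ContDiff ℝ 8 u)
    (hL1 : ∀ k : ℕ, k ≤ 8 → Integrable (iteratedDeriv k u) volume) :
    -- the tempered derivative is well defined: the integral converges and is twice differentiable
    (∀ x : ℝ, IntegrableOn
      (fun s => (x - s) ^ ((⌈α⌉₊ : ℝ) - α - 1) * (Real.exp (lam * s) * u s)) (Iio x) volume) ∧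
    ContDiff ℝ 2 (leftSingularIntegral α (fun s => Real.exp (lam * s) * u s)) ∧
    -- the series defining the difference operators converge
    (∀ p : ℤ, ∀ h : ℝ, 0 < h → ∀ x : ℝ, Summable (temperedGrunwaldTerm α lam p h u x)) ∧
    -- fifth order accuracy, uniformly in `x`
    (∃ C : ℝ, ∃ h₀ : ℝ, 0 < h₀ ∧ ∀ h : ℝ, 0 < h → h ≤ h₀ → ∀ x : ℝ,
      |quasiCompactOp α lam h (leftTemperedDeriv α lam u) x
        - (coeffMuOne α * temperedGrunwald α lam 1 h u x
          + coeffMuZero α * temperedGrunwald α lam 0 h u x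
          + coeffMuNegOne α * temperedGrunwald α lam (-1) h u x)| ≤ C * h ^ 5) := by
  have hui : Integrable u := by simpa using hL1 0 (by norm_num)
  obtain ⟨C, hC⟩ := exists_fourier_decay (n := 8) hu hL1
  set φ : ℝ → ℂ := FourierTransform.fourier fun x => (u x : ℂ) with hφdef
  have hφ : Continuous φ := VectorFourier.fourierIntegral_continuous Real.continuous_fourierChar
    (by fun_prop) hui.ofReal
  have hφi : Integrable φ := integrable_of_decay hφ hC (by norm_num)
  have hrep : ∀ x, lineTransform 0 φ x = u x := lineTransform_fourier hu.continuous hui hφi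
  refine ⟨fun x => ?_, ?_, fun p h hh x => ?_, ?_⟩
  · have hB : ∀ x, |u x| ≤ ∫ ω, ‖φ ω‖ := fun x => by
      rw [← Real.norm_eq_abs, ← Complex.norm_real, ← hrep]
      exact norm_lineTransform_zero_le φ x
    rw [integrableOn_Iio_iff_comp_sub_left, natCeil_eq_two hα₁ hα₂]
    simpa using integrableOn_rpow_mul_comp_sub hui hB (β := 2 - α) (by linarith) (by linarith)
      hlam x
  · exact (deriv_leftSingularIntegral hα₁ hα₂ hlam hui hφ hC (by norm_num; linarith) hrep).1
  · exact Complex.summable_ofReal.1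
      (hasSum_temperedGrunwaldTerm hα₁ hα₂ hlam hh hφi hrep p x).summable
  -- With `r = 8` the requirement `α + 6 < r` is exactly `α < 2`.
  · obtain ⟨K, hK⟩ := exists_truncationError_bound hα₁ hα₂ hlam hden hui hφ hC
      (by norm_num; linarith) hrep
    exact ⟨K, 1, one_pos, hK⟩
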